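/- **Setting.** All systems are finite-dimensional complex Hilbert spaces with fixed orthonormal bases, $\log=\log_2$, and values may be $+\infty$. A channel is a completely positive (CP) trace-preserving linear map. A *bidirectional channel* $\mathcal N_{A_1B_1\to A_2B_2}$ is a channel from $A_1B_1$ to $A_2B_2$ (of nonzero dimension), where $A_1,A_2$ are held by Alice and $B_1,B_2$ by Bob. $J_{\mathcal N}$ denotes its Choi matrix $(\mathrm{id}\otimes\mathcal N)(|\Phi\rangle\langle\Phi|)$, $|\Phi\rangle=\sum_i|i\rangle|i\rangle$, and $T_{X}$ partial transposition on $X$. **Divergence.** For $\alpha\in(1,2]$, a state $\rho$ and $\sigma\ge 0$, the geometric Rényi divergence is $$\widehat D_\alpha(\rho\|\sigma)=\tfrac1{\alpha-1}\log \operatorname{tr}G_{1-\alpha}(\rho,\sigma)\ \text{ if }\operatorname{supp}\rho\subseteq\operatorname{supp}\sigma,\qquad +\infty\text{ otherwise,}$$ where $G_\beta(X,Y)=X^{1/2}(X^{-1/2}YX^{-1/2})^{\beta}X^{1/2}$ for positive definite $X,Y$. Since then $G_{1-\alpha}(\rho,\sigma)=G_\alpha(\sigma,\rho)$, for singular $\rho$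 or $\sigma$ with $\operatorname{supp}\rho\subseteq\operatorname{supp}\sigma$ one reads $G_{1-\alpha}(\rho,\sigma)$ as $\sigma^{1/2}(\sigma^{-1/2}\rho\,\sigma^{-1/2})^{\alpha}\sigma^{1/2}$, with $\sigma^{-1/2}$ the inverse on the support. For a channel $\mathcal N$ and a CP map $\mathcal M$ put $\widehat D_\alpha(\mathcal N\|\mathcal M)=\sup_{\phi}\widehat D_\alpha(\mathcal N(\phi)\|\mathcal M(\phi))$, over all pure states $\phi$ of the input and a reference system of any finite dimension. **Bounds.** Let $\mathcal V_\Theta^{\mathrm{bi}}$ be the set of CP maps $\mathcal M_{A_1B_1\to A_2B_2}$ for which there is $R$ with $R\pm J_{\mathcal M}^{T_{B_1B_2}}\ge0$ and $\operatorname{tr}_{A_2B_2}R\le \mathbf 1_{A_1B_1}$. Define $$\widehat R^{\mathrm{bi}}_{\alpha,\Theta}(\mathcal N)=\inf_{\mathcal M\in\mathcal V_\Theta^{\mathrm{bi}}}\widehat D_\alpha(\mathcal N\|\mathcal M),\qquad R^{\mathrm{bi}}_{\max}(\mathcal N)=\log\inf\{\|\operatorname{tr}_{A_2B_2}(V+Y)\|_\infty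 : V,Y\ge0,\ (V-Y)^{T_{B_1B_2}}\ge J_{\mathcal N}\}.$$ **Capacities.** Let $\mathcal O$ be either the class PPT of bipartite channels $\mathcal P_{AB\to A'B'}$ for which $T_{B'}\circ\mathcal P\circ T_B$ is CP, or the class LOCC of channels realised by finitely many rounds of local quantum instruments and two-way classical communication. An $\mathcal O$-assisted protocol with $n$ uses of $\mathcal N$ prepares a state by an operation of $\mathcal O$ acting on the trivial system and then, $n$ times, applies $\mathcal N$ (each party may keep a finite-dimensional memory) followed by an operation of $\mathcal O$. It is an $(n,m,\varepsilon)$ protocol if its final state $\omega$ lives on $M_AM_B$ with $\dim M_A=\dim M_B=m$ and $\operatorname{tr}(\Phi_m\omega)\ge1-\varepsilon$, where $\Phi_m=\frac1m\sum_{i,j}|ii\rangle\langle jj|$. A real number $r$ is *achievable* if for all $\varepsilon,\delta>0$ and all sufficiently large $n$ there is an $(n,m,\varepsilon)$ protocol with $\log m\ge n(r-\delta)$; it is a *strong converse rate* if for all $\varepsilon\in[0,1)$, $\delta>0$ and all sufficiently large $n$ there is no $(n,m,\varepsilon)$ protocol with $\log m\ge n(r+\delta)$. The capacity is the supremum of the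 achievable rates and the strong converse capacity is the infimum of the strong converse rates. They are written $Q^{\mathrm{bi,PPT},\leftrightarrow}(\mathcal N)$ and $Q^{\mathrm{bi,PPT},\leftrightarrow,\dagger}(\mathcal N)$ for PPT, and $Q^{\mathrm{bi},\leftrightarrow}(\mathcal N)$ and $Q^{\mathrm{bi},\leftrightarrow,\dagger}(\mathcal N)$ (two-way assisted) for LOCC. **Theorem.** For every bidirectional channel $\mathcal N_{A_1B_1\to A_2B_2}$ and every $\alpha\in(1,2]$, $$Q^{\mathrm{bi,PPT},\leftrightarrow}(\mathcal N)\le Q^{\mathrm{bi,PPT},\leftrightarrow,\dagger}(\mathcal N)\le\widehat R^{\mathrm{bi}}_{\alpha,\Theta}(\mathcal N)\le R^{\mathrm{bi}}_{\max}(\mathcal N),$$ and likewise $$Q^{\mathrm{bi},\leftrightarrow}(\mathcal N)\le Q^{\mathrm{bi},\leftrightarrow,\dagger}(\mathcal N)\le\widehat R^{\mathrm{bi}}_{\alpha,\Theta}(\mathcal N)\le R^{\mathrm{bi}}_{\max}(\mathcal N).$$ -/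

import Mathlib

open scoped Matrix ComplexOrder

noncomputable section

namespace BidirectionalCapacity

/-! ### Linear maps on operators, channels

A finite-dimensional system is given by the finite index type of an orthonormal basis; operators on
it are complex square matrices. The joint system of Alice (index `a`) and Bob (index `b`) has index
type `a × b`. -/

/-- Linear maps from operators on `a` to operators on `b`. -/
abbrev OpMap (a b : Type) : Type := Matrix a a ℂ →ₗ[ℂ] Matrix b b ℂ

/-- Linear maps from operators on Alice and Bob's system `a × b` to operators on `a' × b'`. -/
abbrev BiMap (a b a' b' : Type) : Type := OpMap (a × b) (a' × b')

/-- `id_r ⊗ N`. -/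
def idTensor (r : Type) {a b : Type} (N : OpMap a b) : OpMap (r × a) (r × b) where
  toFun X := Matrix.of fun p q => N (X.submatrix (Prod.mk p.1) (Prod.mk q.1)) p.2 q.2
  map_add' X Y := by ext p q; simp [Matrix.submatrix_add]
  map_smul' c X := by ext p q; simp [Matrix.submatrix_smul]

/-- `N ⊗ id_r`. -/
def tensorId {a b : Type} (N : OpMap a b) (r : Type) : OpMap (a × r) (b × r) where
  toFun X := Matrix.of fun p q =>
    N (X.submatrix (fun i => (i, p.2)) (fun j => (j, q.2))) p.1 q.1
  map_add' X Y := by ext p q; simp [Matrix.submatrix_add]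
  map_smul' c X := by ext p q; simp [Matrix.submatrix_smul]

/-- The action of `N_{A₁B₁ → A₂B₂}` on a state of `(x A₁) : (y B₁)`, where Alice keeps a memory `x`
and Bob a memory `y`, that is `id_x ⊗ id_y ⊗ N` with the systems of each party grouped. -/
def onShared (x y : Type) {a₁ b₁ a₂ b₂ : Type} (N : BiMap a₁ b₁ a₂ b₂) :
    BiMap (x × a₁) (y × b₁) (x × a₂) (y × b₂) where
  toFun X := Matrix.of fun p q =>
    N (X.submatrix (fun s => ((p.1.1, s.1), (p.2.1, s.2))) (fun s => ((q.1.1, s.1), (q.2.1, s.2))))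
      (p.1.2, p.2.2) (q.1.2, q.2.2)
  map_add' X Y := by ext p q; simp [Matrix.submatrix_add]
  map_smul' c X := by ext p q; simp [Matrix.submatrix_smul]

/-- Complete positivity: `id_k ⊗ N` preserves positive semidefiniteness for every `k`. -/
def IsCP {a b : Type} (N : OpMap a b) : Prop :=
  ∀ (k : ℕ) (X : Matrix (Fin k × a) (Fin k × a) ℂ), X.PosSemidef → (idTensor (Fin k) N X).PosSemidef

/-- Quantum channels: completely positive and trace preserving maps. -/
def IsChannel {a b : Type} [Fintype a] [Fintype b] (N : OpMap a b) : Prop :=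
  IsCP N ∧ ∀ X, (N X).trace = X.trace

/-- The Choi matrix `J_N = (id ⊗ N)(|Φ⟩⟨Φ|)`, `|Φ⟩ = ∑ i, |i⟩|i⟩`: its `((i, k), (j, l))` entry is
the `(k, l)` entry of `N |i⟩⟨j|`. -/
def choi {a b : Type} [DecidableEq a] (N : OpMap a b) : Matrix (a × b) (a × b) ℂ :=
  Matrix.of fun p q => N (Matrix.single p.1 q.1 1) p.2 q.2

/-- Partial trace over the second factor. -/
def traceRight {a b : Type} [Fintype b] (X : Matrix (a × b) (a × b) ℂ) : Matrix a a ℂ :=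
  Matrix.of fun i j => ∑ k, X (i, k) (j, k)

/-- The partial transpose `T_B` of operators on `A B`. -/
def transposeBob (a b : Type) : OpMap (a × b) (a × b) where
  toFun X := Matrix.of fun p q => X (p.1, q.2) (q.1, p.2)
  map_add' X Y := by ext p q; simp
  map_smul' c X := by ext p q; simp

/-- The partial transpose `T_{B₁B₂}` of operators on `(A₁ B₁) (A₂ B₂)`. -/
def choiTransposeBob {a₁ b₁ a₂ b₂ : Type}
    (X : Matrix ((a₁ × b₁) × (a₂ × b₂)) ((a₁ × b₁) × (a₂ × b₂)) ℂ) :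
    Matrix ((a₁ × b₁) × (a₂ × b₂)) ((a₁ × b₁) × (a₂ × b₂)) ℂ :=
  Matrix.of fun p q =>
    X ((p.1.1, q.1.2), (p.2.1, q.2.2)) ((q.1.1, p.1.2), (q.2.1, p.2.2))

/-- The operator norm `‖X‖_∞` with respect to the Euclidean norm. -/
def opNorm {a : Type} [Fintype a] [DecidableEq a] (X : Matrix a a ℂ) : ℝ :=
  ‖Matrix.toEuclideanCLM (𝕜 := ℂ) X‖

/-! ### The geometric Rényi divergence -/

/-- The real power `X ^ s` of a positive semidefinite matrix. Negative powers are taken on the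
support, as `0 ^ s = 0` for `s ≠ 0`. -/
def mpow {a : Type} [Fintype a] [DecidableEq a] (X : Matrix a a ℂ) (s : ℝ) : Matrix a a ℂ :=
  cfc (fun t : ℝ => t ^ s) X

/-- The weighted matrix geometric mean
`G_β(X, Y) = X^{1/2} (X^{-1/2} Y X^{-1/2})^β X^{1/2}`. -/
def geomMean {a : Type} [Fintype a] [DecidableEq a] (β : ℝ) (X Y : Matrix a a ℂ) :
    Matrix a a ℂ :=
  mpow X (1 / 2) * mpow (mpow X (-(1 / 2)) * Y * mpow X (-(1 / 2))) β * mpow X (1 / 2)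

theorem mpow_mul_mpow {a : Type} [Fintype a] [DecidableEq a] {X : Matrix a a ℂ} (hX : X.PosDef)
    (s t : ℝ) : mpow X s * mpow X t = mpow X (s + t) := by
  have hfin : (spectrum ℝ X).Finite := Matrix.finite_real_spectrum
  unfold mpow
  rw [← cfc_mul _ _ X (hfin.continuousOn _) (hfin.continuousOn _)]
  refine cfc_congr fun x hx => ?_
  rw [hX.1.spectrum_real_eq_range_eigenvalues] at hx
  obtain ⟨i, rfl⟩ := hx
  exact (Real.rpow_add (hX.eigenvalues_pos i) s t).symm

theorem mpow_at_zero {a : Type} [Fintype a] [DecidableEq a] {X : Matrix a a ℂ} (hX : X.PosDef) :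
    mpow X 0 = 1 := by
  simp only [mpow, Real.rpow_zero]
  exact cfc_const_one ℝ X hX.1.isSelfAdjoint

theorem mpow_at_one {a : Type} [Fintype a] [DecidableEq a] {X : Matrix a a ℂ} (hX : X.PosDef) :
    mpow X 1 = X := by
  simp only [mpow, Real.rpow_one]
  exact cfc_id' ℝ X hX.1.isSelfAdjoint

theorem mpow_herm {a : Type} [Fintype a] [DecidableEq a] (X : Matrix a a ℂ) (s : ℝ) :
    (mpow X s)ᴴ = mpow X s := (IsSelfAdjoint.cfc (f := fun t : ℝ => t ^ s) (a := X)).star_eq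

theorem mul_mpow_comm {a : Type} [Fintype a] [DecidableEq a] (U : Matrix a a ℂ) (s : ℝ) :
    U * mpow (Uᴴ * U) s = mpow (U * Uᴴ) s * U := by
  classical
  have h1 : (spectrum ℝ (Uᴴ * U)).Finite := Matrix.finite_real_spectrum
  have h2 : (spectrum ℝ (U * Uᴴ)).Finite := Matrix.finite_real_spectrum
  let S := h1.toFinset ∪ h2.toFinset
  let p := Lagrange.interpolate S id (fun t : ℝ => t ^ s)
  have hp : ∀ t ∈ S, p.eval t = t ^ s := fun t ht =>
    Lagrange.eval_interpolate_at_node (v := id) _ (Function.injective_id.injOn) ht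
  have e1 : mpow (Uᴴ * U) s = Polynomial.aeval (Uᴴ * U) p := by
    rw [← cfc_polynomial p _ (Matrix.isHermitian_conjTranspose_mul_self U).isSelfAdjoint]
    exact cfc_congr fun t ht => (hp t (by simp [S, ht])).symm
  have e2 : mpow (U * Uᴴ) s = Polynomial.aeval (U * Uᴴ) p := by
    rw [← cfc_polynomial p _ (Matrix.isHermitian_mul_conjTranspose_self U).isSelfAdjoint]
    exact cfc_congr fun t ht => (hp t (by simp [S, ht])).symm
  rw [e1, e2]
  generalize p = q
  have hpow : ∀ n : ℕ, U * (Uᴴ * U) ^ n = (U * Uᴴ) ^ n * U := by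
    intro n
    induction n with
    | zero => simp
    | succ n ih => rw [pow_succ, pow_succ, ← mul_assoc, ih]; simp only [mul_assoc]
  induction q using Polynomial.induction_on' with
  | add p q hp hq => simp [mul_add, add_mul, hp, hq]
  | monomial n c => simp [Polynomial.aeval_monomial, Algebra.algebraMap_eq_smul_one, hpow]

/-- For positive definite matrices `G_{1-α}(ρ, σ) = G_α(σ, ρ)`. -/
theorem geomMean_swap {a : Type} [Fintype a] [DecidableEq a] {ρ σ : Matrix a a ℂ}
    (hρ : ρ.PosDef) (hσ : σ.PosDef) (α : ℝ) : geomMean (1 - α) ρ σ = geomMean α σ ρ := by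
  unfold geomMean
  have hr : mpow ρ (1/2) * mpow ρ (-(1/2)) = 1 := by
    rw [mpow_mul_mpow hρ, add_neg_cancel, mpow_at_zero hρ]
  have hr' : mpow ρ (-(1/2)) * mpow ρ (1/2) = 1 := by
    rw [mpow_mul_mpow hρ, neg_add_cancel, mpow_at_zero hρ]
  have hs : mpow σ (1/2) * mpow σ (-(1/2)) = 1 := by
    rw [mpow_mul_mpow hσ, add_neg_cancel, mpow_at_zero hσ]
  have hs' : mpow σ (-(1/2)) * mpow σ (1/2) = 1 := by
    rw [mpow_mul_mpow hσ, neg_add_cancel, mpow_at_zero hσ]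
  have hrr : mpow ρ (1/2) * mpow ρ (1/2) = ρ := by
    rw [mpow_mul_mpow hρ, add_halves, mpow_at_one hρ]
  have hss : mpow σ (1/2) * mpow σ (1/2) = σ := by
    rw [mpow_mul_mpow hσ, add_halves, mpow_at_one hσ]
  have Hr := mpow_herm ρ (-(1/2))
  have Hr1 := mpow_herm ρ (1/2)
  have Hs1 := mpow_herm σ (-(1/2))
  generalize mpow ρ (-(1/2)) = r' at *
  generalize mpow ρ (1/2) = r at *
  generalize mpow σ (-(1/2)) = s' at *
  generalize mpow σ (1/2) = s at *
  have hU := mul_mpow_comm (r * s') α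
  rw [Matrix.conjTranspose_mul, Hr1, Hs1] at hU
  have hC : s' * r * (r * s') = s' * ρ * s' := by rw [← hrr]; simp only [mul_assoc]
  rw [hC] at hU
  have hA : (r' * σ * r').PosDef := by
    have : IsUnit r' := IsUnit.of_mul_eq_one r hr'
    have := hσ.conjTranspose_mul_mul_same (B := r') (Matrix.mulVec_injective_of_isUnit this)
    rwa [Hr] at this
  have hinv : r * s' * (s' * r) * (r' * σ * r') = 1 := by
    calc r * s' * (s' * r) * (r' * σ * r') = r * s' * s' * (r * r') * σ * r' := by
          simp only [mul_assoc]
      _ = r * s' * (s' * s) * s * r' := by rw [hr, ← hss]; simp only [mul_assoc, one_mul]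
      _ = 1 := by rw [hs', mul_one, mul_assoc r, hs', mul_one, hr]
  have hpow : mpow (r * s' * (s' * r)) α = mpow (r' * σ * r') (-α) := by
    let u : (Matrix a a ℂ)ˣ := ⟨r' * σ * r', r * s' * (s' * r), mul_eq_one_comm.mp hinv, hinv⟩
    have h := cfc_comp_inv (R := ℝ) (fun t : ℝ => t ^ α) u
      (((Matrix.finite_real_spectrum (A := (u : Matrix a a ℂ))).image _).continuousOn _)
      hA.1.isSelfAdjoint
    refine h.symm.trans (cfc_congr fun t ht => ?_)
    change t ∈ spectrum ℝ (r' * σ * r') at ht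
    rw [hA.1.spectrum_real_eq_range_eigenvalues] at ht
    obtain ⟨i, rfl⟩ := ht
    simp only [Real.rpow_neg (hA.eigenvalues_pos i).le, Real.inv_rpow (hA.eigenvalues_pos i).le]
  rw [hpow] at hU
  have hsplit : mpow (r' * σ * r') (1 - α) = r' * σ * r' * mpow (r' * σ * r') (-α) := by
    nth_rewrite 2 [← mpow_at_one hA]
    rw [mpow_mul_mpow hA, sub_eq_add_neg]
  have key : s' * mpow (s' * ρ * s') α * s = r' * mpow (r' * σ * r') (-α) * r := by
    calc s' * mpow (s' * ρ * s') α * s = (r' * r) * s' * mpow (s' * ρ * s') α * s := by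
          rw [hr', one_mul]
      _ = r' * (r * s' * mpow (s' * ρ * s') α) * s := by simp only [mul_assoc]
      _ = r' * mpow (r' * σ * r') (-α) * r * (s' * s) := by rw [hU]; simp only [mul_assoc]
      _ = _ := by rw [hs', mul_one]
  calc r * mpow (r' * σ * r') (1 - α) * r
      = r * r' * σ * (r' * mpow (r' * σ * r') (-α) * r) := by rw [hsplit]; simp only [mul_assoc]
    _ = s * (s * s') * mpow (s' * ρ * s') α * s := by
        rw [← key, hr, one_mul, ← hss]; simp only [mul_assoc]
    _ = _ := by rw [hs, mul_one]

/-- `ρ ≪ σ` for Hermitian matrices: the support (the orthogonal complement of the kernel) of `ρ`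
is contained in the support of `σ`. -/
def SuppLE {a : Type} [Fintype a] (ρ σ : Matrix a a ℂ) : Prop :=
  LinearMap.ker σ.mulVecLin ≤ LinearMap.ker ρ.mulVecLin

open Classical in
/-- The geometric Rényi divergence (base two), `(α - 1)⁻¹ log tr G_{1-α}(ρ, σ)` if `ρ ≪ σ` and `+∞`
otherwise. For positive definite matrices `G_{1-α}(ρ, σ) = G_α(σ, ρ)` by `geomMean_swap`. The right-hand side,
with the inverse of `σ` taken on its support, is the value for all `ρ ≪ σ`: it is the limit as `ε ↓ 0` of
`G_{1-α}(ρ + ε, σ + ε)`, and is what the left-hand side stands for when `ρ` is singular. -/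
def geomDiv {a : Type} [Fintype a] [DecidableEq a] (α : ℝ) (ρ σ : Matrix a a ℂ) : EReal :=
  if SuppLE ρ σ then
    (((α - 1)⁻¹ * Real.logb 2 (geomMean α σ ρ).trace.re : ℝ) : EReal)
  else ⊤

/-- The geometric Rényi channel divergence: the maximum of the divergence of the outputs
`(id_R ⊗ N)(φ)` and `(id_R ⊗ M)(φ)` over pure states `φ = |ψ⟩⟨ψ|` of the input and a reference
system `R` of any finite dimension `k`. -/
def geomChannelDiv {a b : Type} [Fintype a] [Fintype b] [DecidableEq b] (α : ℝ)
    (N M : OpMap a b) : EReal :=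
  ⨆ (k : ℕ) (ψ : Fin k × a → ℂ) (_ : ∑ i, ‖ψ i‖ ^ 2 = 1),
    geomDiv α (idTensor (Fin k) N (Matrix.vecMulVec ψ (star ψ)))
      (idTensor (Fin k) M (Matrix.vecMulVec ψ (star ψ)))

/-! ### Bidirectional Theta-information and max-Rains information -/

section Bounds

variable {a₁ b₁ a₂ b₂ : Type} [Fintype a₁] [Fintype b₁] [Fintype a₂] [Fintype b₂]
  [DecidableEq a₁] [DecidableEq b₁] [DecidableEq a₂] [DecidableEq b₂]

/-- The bidirectional Theta set: completely positive maps `M` for which there is an `R` with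
`R ± J_M^{T_{B₁B₂}} ≥ 0` and `tr_{A₂B₂} R ≤ 1`. -/
def thetaSet (a₁ b₁ a₂ b₂ : Type) [Fintype a₂] [Fintype b₂] [DecidableEq a₁] [DecidableEq b₁] :
    Set (BiMap a₁ b₁ a₂ b₂) :=
  {M | IsCP M ∧ ∃ R : Matrix ((a₁ × b₁) × (a₂ × b₂)) ((a₁ × b₁) × (a₂ × b₂)) ℂ,
    (R + choiTransposeBob (choi M)).PosSemidef ∧ (R - choiTransposeBob (choi M)).PosSemidef ∧
    (1 - traceRight R).PosSemidef}

/-- The bidirectional geometric Rényi Theta-information. -/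
def geomThetaInfo (α : ℝ) (N : BiMap a₁ b₁ a₂ b₂) : EReal :=
  ⨅ M ∈ thetaSet a₁ b₁ a₂ b₂, geomChannelDiv α N M

/-- The bidirectional max-Rains information: `log` of the minimum of `‖tr_{A₂B₂} (V + Y)‖_∞` over
`V, Y ≥ 0` with `(V - Y)^{T_{B₁B₂}} ≥ J_N`. -/
def maxRainsInfo (N : BiMap a₁ b₁ a₂ b₂) : ℝ :=
  Real.logb 2 (sInf {y : ℝ | ∃ V Y : Matrix ((a₁ × b₁) × (a₂ × b₂)) ((a₁ × b₁) × (a₂ × b₂)) ℂ,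
    V.PosSemidef ∧ Y.PosSemidef ∧ (choiTransposeBob (V - Y) - choi N).PosSemidef ∧
    y = opNorm (traceRight (V + Y))})

end Bounds

/-! ### Free operations: PPT channels and LOCC channels -/

/-- A class of bipartite operations, for all finite-dimensional systems. -/
abbrev OpClass : Type 1 :=
  ∀ ⦃a b a' b' : Type⦄ [Fintype a] [Fintype b] [Fintype a'] [Fintype b'], BiMap a b a' b' → Prop

/-- (Completely) PPT-preserving channels: channels `P` for which `T_{B'} ∘ P ∘ T_B` is completely
positive. -/
def PPT : OpClass := fun a b a' b' _ _ _ _ P =>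
  IsChannel P ∧ IsCP (transposeBob a' b' ∘ₗ P ∘ₗ transposeBob a b)

/-- Channels realised by finitely many rounds of local operations and classical communication: the
parties stop, or one of them applies a local quantum instrument `(E k)_k`, announces the outcome
`k`, and they go on with a protocol `L k` that may depend on `k`. -/
inductive IsLOCC (a' b' : Type) : ∀ (a b : Type) [Fintype a] [Fintype b], BiMap a b a' b' → Prop
  | done [Fintype a'] [Fintype b'] : IsLOCC a' b' a' b' LinearMap.id
  | alice (a b : Type) [Fintype a] [Fintype b] {κ : Type} [Fintype κ]
      (c : κ → Type) [∀ k, Fintype (c k)] (E : ∀ k, OpMap a (c k))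
      (L : ∀ k, BiMap (c k) b a' b')
      (cp : ∀ k, IsCP (E k)) (tp : ∀ X, ∑ k, (E k X).trace = X.trace)
      (rest : ∀ k, IsLOCC a' b' (c k) b (L k)) :
      IsLOCC a' b' a b (∑ k, L k ∘ₗ tensorId (E k) b)
  | bob (a b : Type) [Fintype a] [Fintype b] {κ : Type} [Fintype κ]
      (c : κ → Type) [∀ k, Fintype (c k)] (E : ∀ k, OpMap b (c k))
      (L : ∀ k, BiMap a (c k) a' b')
      (cp : ∀ k, IsCP (E k)) (tp : ∀ X, ∑ k, (E k X).trace = X.trace)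
      (rest : ∀ k, IsLOCC a' b' a (c k) (L k)) :
      IsLOCC a' b' a b (∑ k, L k ∘ₗ idTensor a (E k))

/-- The class of LOCC channels. -/
def LOCC : OpClass := fun a b a' b' _ _ _ _ P => IsLOCC a' b' a b P

/-! ### Protocols and capacities -/

/-- `Prepares O N n ω`: Alice and Bob can prepare the state `ω` by a protocol with `n` uses of `N`,
interleaved with operations of the class `O`. They start from nothing (the trivial system) by an
operation of `O`; each use of `N`, during which they may keep memories `x` and `y` of any finite
dimension, is followed by an operation of `O`. -/
inductive Prepares (O : OpClass) {a₁ b₁ a₂ b₂ : Type} [Fintype a₁] [Fintype b₁] [Fintype a₂]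
    [Fintype b₂] (N : BiMap a₁ b₁ a₂ b₂) :
    ℕ → ∀ (a b : Type) [Fintype a] [Fintype b], Matrix (a × b) (a × b) ℂ → Prop
  | start (a b : Type) [Fintype a] [Fintype b] (P : BiMap Unit Unit a b) (hP : O P) :
      Prepares O N 0 a b (P 1)
  | use (n : ℕ) (x y a b : Type) [Fintype x] [Fintype y] [Fintype a] [Fintype b]
      (ρ : Matrix ((x × a₁) × (y × b₁)) ((x × a₁) × (y × b₁)) ℂ)
      (hρ : Prepares O N n (x × a₁) (y × b₁) ρ)
      (P : BiMap (x × a₂) (y × b₂) a b) (hP : O P) :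
      Prepares O N (n + 1) a b (P (onShared x y N ρ))

/-- The maximally entangled state `Φ_m = (1/m) ∑ i j, |i i⟩⟨j j|`. -/
def maxEnt (m : ℕ) : Matrix (Fin m × Fin m) (Fin m × Fin m) ℂ :=
  Matrix.of fun p q => if p.1 = p.2 ∧ q.1 = q.2 then (1 / m : ℂ) else 0

section Capacities

variable {a₁ b₁ a₂ b₂ : Type} [Fintype a₁] [Fintype b₁] [Fintype a₂] [Fintype b₂]

/-- There is an `O`-assisted protocol with `n` uses of `N` whose final state `ω` has fidelity
`tr (Φ_m ω) ≥ 1 - ε` with the maximally entangled state of local dimension `m`. -/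
def HasProtocol (O : OpClass) (N : BiMap a₁ b₁ a₂ b₂) (n m : ℕ) (ε : ℝ) : Prop :=
  ∃ ω : Matrix (Fin m × Fin m) (Fin m × Fin m) ℂ,
    Prepares O N n (Fin m) (Fin m) ω ∧ 1 - ε ≤ (maxEnt m * ω).trace.re

/-- `r` is an achievable rate: for all `ε, δ > 0` and all large `n` there is a protocol of rate
`(log m) / n ≥ r - δ` and error at most `ε`. -/
def IsAchievable (O : OpClass) (N : BiMap a₁ b₁ a₂ b₂) (r : ℝ) : Prop :=
  ∀ ε > 0, ∀ δ > 0, ∀ᶠ n : ℕ in Filter.atTop,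
    ∃ m : ℕ, n * (r - δ) ≤ Real.logb 2 m ∧ HasProtocol O N n m ε

/-- `r` is a strong converse rate: for all `ε ∈ [0, 1)` and `δ > 0` and all large `n` there is no
protocol of rate `(log m) / n ≥ r + δ` and error at most `ε`. -/
def IsStrongConverse (O : OpClass) (N : BiMap a₁ b₁ a₂ b₂) (r : ℝ) : Prop :=
  ∀ ε, 0 ≤ ε → ε < 1 → ∀ δ > 0, ∀ᶠ n : ℕ in Filter.atTop,
    ∀ m : ℕ, n * (r + δ) ≤ Real.logb 2 m → ¬ HasProtocol O N n m ε

/-- The `O`-assisted quantum capacity: the supremum of the achievable rates. -/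
def capacity (O : OpClass) (N : BiMap a₁ b₁ a₂ b₂) : EReal :=
  ⨆ (r : ℝ) (_ : IsAchievable O N r), (r : EReal)

/-- The strong converse `O`-assisted quantum capacity: the infimum of the strong converse rates. -/
def strongConverseCapacity (O : OpClass) (N : BiMap a₁ b₁ a₂ b₂) : EReal :=
  ⨅ (r : ℝ) (_ : IsStrongConverse O N r), (r : EReal)

end Capacities

end BidirectionalCapacity

end

open BidirectionalCapacity

/-! The strong converse compares a protocol that uses `N` with the same protocol in which every `N`
is replaced by some `M` in the Theta set. Two quantities are followed through the rounds.

The first measures how far the two protocols drift apart. The geometric mean of `choi M` and `choi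
N` comes from a simultaneous diagonalisation: `M = ∑ F_k · F_k*` and `N = ∑ μ_k F_k · F_k*`, where
`∑ μ_k ^ α F_k* F_k` is the dual form of `G_α`. A channel divergence of at most `t` says exactly
that this sum is at most `c = 2 ^ ((α - 1) t)` (`RevTestMap.of_geomChannelDiv_le`; pure inputs of
full Schmidt rank suffice, by `geomMean_congruence`). Such decompositions compose by multiplying
weights (`RevTestMap.apply`), so `n` uses cost `c ^ n`, whatever operations come in between.

The second is the trace norm of the partial transpose. PPT operations and maps of the Theta set keep
it at most one (`TransposeBounded.theta`), so the comparison state overlaps `Φ_m` by at most `1 /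
m`. Hölder's inequality combines the two: the fidelity is at most `(1 / m) ^ (1 - 1/α) * c ^ (n /
α)`, which decays exponentially once `log m ≥ n (t + δ)`.

LOCC channels are PPT, so the bound covers LOCC protocols. For the last inequality, a feasible pair
`V, Y` of value `y` rescales to a map `M` of the Theta set with `N ≤ y M`, and this forces the
divergence to be at most `log y`. -/

noncomputable section

namespace BidirectionalCapacity

/-! ### Matrix preliminaries -/

section MatrixFacts

open Matrix

variable {a b c : Type} [Fintype a] [Fintype b] [Fintype c]

/-- Diagonalisation of a positive semidefinite matrix together with all its real powers. -/
theorem exists_spectral [DecidableEq a] {X : Matrix a a ℂ} (hX : X.PosSemidef) :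
    ∃ (U : Matrix a a ℂ) (l : a → ℝ), (∀ i, 0 ≤ l i) ∧ Uᴴ * U = 1 ∧ U * Uᴴ = 1 ∧
      X = U * diagonal (fun i => (l i : ℂ)) * Uᴴ ∧
      ∀ s : ℝ, mpow X s = U * diagonal (fun i => ((l i ^ s : ℝ) : ℂ)) * Uᴴ := by
  refine ⟨hX.1.eigenvectorUnitary, hX.1.eigenvalues, hX.eigenvalues_nonneg, ?_, ?_, ?_, ?_⟩
  · exact Unitary.coe_star_mul_self hX.1.eigenvectorUnitary
  · exact Unitary.coe_mul_star_self hX.1.eigenvectorUnitary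
  · have h := hX.1.spectral_theorem
    rw [Unitary.conjStarAlgAut_apply] at h
    exact h
  · intro s
    rw [mpow, hX.1.cfc_eq, IsHermitian.cfc, Unitary.conjStarAlgAut_apply]
    rfl

theorem mpow_half_mul_self [DecidableEq a] {X : Matrix a a ℂ} (hX : X.PosSemidef) :
    mpow X (1 / 2) * mpow X (1 / 2) = X := by
  obtain ⟨U, l, hl, hU, -, hX', h⟩ := exists_spectral hX
  rw [h (1 / 2)]
  calc _ = U * diagonal (fun i => ((l i ^ (1 / 2 : ℝ) : ℝ) : ℂ)) * (Uᴴ * U) *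
        diagonal (fun i => ((l i ^ (1 / 2 : ℝ) : ℝ) : ℂ)) * Uᴴ := by simp only [mul_assoc]
    _ = U * diagonal (fun i => (l i : ℂ)) * Uᴴ := by
        rw [hU, mul_one, mul_assoc U, diagonal_mul_diagonal]
        congr 3
        ext i
        rw [← Complex.ofReal_mul, ← Real.sqrt_eq_rpow, Real.mul_self_sqrt (hl i)]
    _ = X := hX'.symm

/-- The projection onto the support of a positive semidefinite matrix. -/
def suppProj [DecidableEq a] (X : Matrix a a ℂ) : Matrix a a ℂ :=
  mpow X (1 / 2) * mpow X (-(1 / 2))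

theorem suppProj_facts [DecidableEq a] {X : Matrix a a ℂ} (hX : X.PosSemidef) :
    (suppProj X)ᴴ = suppProj X ∧ X * suppProj X = X ∧
      mpow X (-(1 / 2)) * suppProj X = mpow X (-(1 / 2)) := by
  obtain ⟨U, l, hl, hU, -, hX', h⟩ := exists_spectral hX
  -- On the kernel the entries are `0`, because `0 ^ s = 0` for `s ≠ 0`; elsewhere the two powers
  -- cancel.
  have hP : suppProj X = U * diagonal (fun i => if l i = 0 then (0 : ℂ) else 1) * Uᴴ := by
    rw [suppProj, h (1 / 2), h (-(1 / 2))]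
    calc _ = U * diagonal (fun i => ((l i ^ (1 / 2 : ℝ) : ℝ) : ℂ)) * (Uᴴ * U) *
          diagonal (fun i => ((l i ^ (-(1 / 2) : ℝ) : ℝ) : ℂ)) * Uᴴ := by simp only [mul_assoc]
      _ = _ := by
          rw [hU, mul_one, mul_assoc U, diagonal_mul_diagonal]
          congr 3
          ext i
          split_ifs with hi
          · simp [hi]
          · rw [← Complex.ofReal_mul, Real.rpow_neg (hl i), mul_inv_cancel₀, Complex.ofReal_one]
            exact (Real.rpow_pos_of_pos (lt_of_le_of_ne (hl i) (Ne.symm hi)) _).ne'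
  have key : ∀ d : a → ℂ, (∀ i, l i = 0 → d i = 0) →
      U * diagonal d * Uᴴ * suppProj X = U * diagonal d * Uᴴ := by
    intro d hd
    rw [hP]
    calc _ = U * diagonal d * (Uᴴ * U) *
          diagonal (fun i => if l i = 0 then (0 : ℂ) else 1) * Uᴴ := by simp only [mul_assoc]
      _ = _ := by
          rw [hU, mul_one, mul_assoc U, diagonal_mul_diagonal]
          congr 3
          ext i
          split_ifs with hi <;> simp [hd, hi]
  refine ⟨?_, ?_, ?_⟩
  · rw [hP]
    simp only [conjTranspose_mul, conjTranspose_conjTranspose, diagonal_conjTranspose, mul_assoc]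
    congr 3
    ext i
    simp only [Pi.star_apply]
    split_ifs <;> simp
  · conv_rhs => rw [hX']
    nth_rewrite 1 [hX']
    exact key _ fun i hi => by simp [hi]
  · rw [h (-(1 / 2))]
    exact key _ fun i hi => by simp [hi]

theorem suppProj_comm [DecidableEq a] {X : Matrix a a ℂ} (hX : X.PosSemidef) :
    mpow X (-(1 / 2)) * mpow X (1 / 2) = suppProj X := by
  have := (suppProj_facts hX).1
  rwa [suppProj, conjTranspose_mul, mpow_herm, mpow_herm] at this

/-- Functions of Hermitian matrices preserve intertwining relations. -/
theorem mpow_intertwine [DecidableEq a] [DecidableEq b] {X : Matrix a a ℂ} {Y : Matrix b b ℂ}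
    {W : Matrix b a ℂ} (hX : X.IsHermitian) (hY : Y.IsHermitian) (h : W * X = Y * W) (s : ℝ) :
    W * mpow X s = mpow Y s * W := by
  have h1 : (spectrum ℝ X).Finite := Matrix.finite_real_spectrum
  have h2 : (spectrum ℝ Y).Finite := Matrix.finite_real_spectrum
  -- A single polynomial interpolates `t ^ s` on both finite spectra, and polynomials inherit the
  -- intertwining relation.
  let S := h1.toFinset ∪ h2.toFinset
  let p := Lagrange.interpolate S id (fun t : ℝ => t ^ s)
  have hp : ∀ t ∈ S, p.eval t = t ^ s := fun t ht =>
    Lagrange.eval_interpolate_at_node (v := id) _ (Function.injective_id.injOn) ht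
  have e1 : mpow X s = Polynomial.aeval X p := by
    rw [← cfc_polynomial p _ hX.isSelfAdjoint]
    exact cfc_congr fun t ht => (hp t (by simp [S, ht])).symm
  have e2 : mpow Y s = Polynomial.aeval Y p := by
    rw [← cfc_polynomial p _ hY.isSelfAdjoint]
    exact cfc_congr fun t ht => (hp t (by simp [S, ht])).symm
  rw [e1, e2]
  generalize p = q
  have hpow : ∀ n : ℕ, W * X ^ n = Y ^ n * W := by
    intro n
    induction n with
    | zero => simp
    | succ n ih => rw [pow_succ, pow_succ, ← Matrix.mul_assoc, ih, Matrix.mul_assoc, h, Matrix.mul_assoc]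
  induction q using Polynomial.induction_on' with
  | add p q hp hq => simp [Matrix.mul_add, Matrix.add_mul, hp, hq]
  | monomial n r => simp [Polynomial.aeval_monomial, Algebra.algebraMap_eq_smul_one, hpow]

theorem mpow_eq_mul_mpow_sub_one [DecidableEq a] {X : Matrix a a ℂ} (hX : X.PosSemidef) {s : ℝ}
    (hs : 1 < s) : mpow X s = X * mpow X (s - 1) := by
  obtain ⟨U, l, hl, hU, -, hX', h⟩ := exists_spectral hX
  rw [h s, h (s - 1)]
  symm
  calc _ = U * diagonal (fun i => (l i : ℂ)) * (Uᴴ * U) *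
        diagonal (fun i => ((l i ^ (s - 1) : ℝ) : ℂ)) * Uᴴ := by
        nth_rewrite 1 [hX']; simp only [mul_assoc]
    _ = _ := by
        rw [hU, mul_one, mul_assoc U, diagonal_mul_diagonal]
        congr 3
        ext i
        rw [← Complex.ofReal_mul]
        congr 1
        rcases (hl i).eq_or_lt with h0 | h0
        · rw [← h0, zero_mul, Real.zero_rpow (by linarith)]
        · rw [Real.rpow_sub_one h0.ne', mul_div_cancel₀ _ h0.ne']

/-- `(W* C W)^s = W* C^s W` if `W W*` acts as the identity on the support of `C`. -/
theorem mpow_compress [DecidableEq a] [DecidableEq b] {C : Matrix b b ℂ} {W : Matrix b a ℂ}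
    (hC : C.PosSemidef) (h : C * W * Wᴴ = C) {s : ℝ} (hs : 1 < s) :
    mpow (Wᴴ * C * W) s = Wᴴ * mpow C s * W := by
  have hX : (Wᴴ * C * W).PosSemidef := hC.conjTranspose_mul_mul_same W
  have h' : W * Wᴴ * C = C := by
    have := congrArg conjTranspose h
    simpa only [conjTranspose_mul, conjTranspose_conjTranspose, hC.1.eq, Matrix.mul_assoc] using this
  have hi : W * (Wᴴ * C * W) = C * W := by
    rw [Matrix.mul_assoc Wᴴ, ← Matrix.mul_assoc W, ← Matrix.mul_assoc, h']
  -- A factor `Wᴴ * C * W` is split off before intertwining; moving `W` through the full power would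
  -- leave `Wᴴ * W`, which need not be the identity.
  rw [mpow_eq_mul_mpow_sub_one hX hs, mpow_eq_mul_mpow_sub_one hC hs, Matrix.mul_assoc,
    mpow_intertwine hX.1 hC.1 hi]
  simp only [Matrix.mul_assoc]

omit [Fintype b] in
theorem SuppLE.mul_eq_zero {ρ σ : Matrix a a ℂ} (h : SuppLE ρ σ) {Z : Matrix a b ℂ}
    (hZ : σ * Z = 0) : ρ * Z = 0 := by
  ext i j
  have h1 : σ *ᵥ Z.col j = 0 := funext fun k => congrFun (congrFun hZ k) j
  exact congrFun (h h1) i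

/-- Since `Kᴴ * K'ᴴ = 1`, every vector `v` is `Kᴴ` applied to `K'ᴴ v`, and `K` is injective, so
kernels can be compared after the congruence. -/
theorem suppLE_of_mul_mul_conjTranspose [DecidableEq a] {ρ σ : Matrix a a ℂ} {K : Matrix b a ℂ}
    {K' : Matrix a b ℂ}
    (hK : K' * K = 1) (h : SuppLE (K * ρ * Kᴴ) (K * σ * Kᴴ)) : SuppLE ρ σ := by
  intro v hv
  have hv : σ *ᵥ v = 0 := hv
  have hK2 : Kᴴ * K'ᴴ = 1 := by rw [← conjTranspose_mul, hK, conjTranspose_one]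
  have key : ∀ τ : Matrix a a ℂ, (K * τ * Kᴴ) *ᵥ (K'ᴴ *ᵥ v) = K *ᵥ (τ *ᵥ v) := by
    intro τ
    rw [mulVec_mulVec, Matrix.mul_assoc, hK2, Matrix.mul_one, mulVec_mulVec]
  have h1 : (K * ρ * Kᴴ) *ᵥ (K'ᴴ *ᵥ v) = 0 := by
    apply h
    change (K * σ * Kᴴ) *ᵥ (K'ᴴ *ᵥ v) = 0
    rw [key, hv, mulVec_zero]
  rw [key] at h1
  have h2 := congrArg (K' *ᵥ ·) h1
  have h3 : ρ *ᵥ v = 0 := by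
    simpa only [mulVec_mulVec, ← Matrix.mul_assoc, hK, mulVec_zero, Matrix.one_mul] using h2
  exact h3

/-- For `ρ ≪ σ` the matrix `σ^{-1/2} ρ σ^{-1/2}` recovers `ρ`. -/
theorem SuppLE.sandwich [DecidableEq a] {ρ σ : Matrix a a ℂ} (hρ : ρ.PosSemidef)
    (hσ : σ.PosSemidef) (h : SuppLE ρ σ) :
    mpow σ (1 / 2) * (mpow σ (-(1 / 2)) * ρ * mpow σ (-(1 / 2))) * mpow σ (1 / 2) = ρ := by
  obtain ⟨hP, hσP, -⟩ := suppProj_facts hσ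
  have h0 : ρ * suppProj σ = ρ := by
    have : ρ * (1 - suppProj σ) = 0 := h.mul_eq_zero (by rw [mul_sub, hσP, mul_one, sub_self])
    rw [mul_sub, mul_one, sub_eq_zero] at this
    exact this.symm
  have h1 : suppProj σ * ρ = ρ := by
    have := congrArg conjTranspose h0
    rwa [conjTranspose_mul, hP, hρ.1.eq] at this
  calc _ = suppProj σ * ρ * (mpow σ (-(1 / 2)) * mpow σ (1 / 2)) := by
        simp only [suppProj, mul_assoc]
    _ = ρ := by rw [suppProj_comm hσ, h1, h0]

theorem mpow_sandwich_posSemidef [DecidableEq a] {ρ : Matrix a a ℂ} (hρ : ρ.PosSemidef)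
    (σ : Matrix a a ℂ) (s : ℝ) : (mpow σ s * ρ * mpow σ s).PosSemidef := by
  have := hρ.mul_mul_conjTranspose_same (mpow σ s)
  rwa [mpow_herm] at this

/-- `ρ ≤ y σ` implies `σ^{-1/2} ρ σ^{-1/2} ≤ y`. -/
theorem sandwich_le [DecidableEq a] {ρ σ : Matrix a a ℂ} (hσ : σ.PosSemidef) {y : ℝ} (hy : 0 ≤ y)
    (h : (y • σ - ρ).PosSemidef) :
    (y • (1 : Matrix a a ℂ) - mpow σ (-(1 / 2)) * ρ * mpow σ (-(1 / 2))).PosSemidef := by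
  obtain ⟨hP, -, hsP⟩ := suppProj_facts hσ
  have hPP : suppProj σ * suppProj σ = suppProj σ := by
    nth_rewrite 1 [suppProj]
    rw [mul_assoc, hsP, suppProj]
  have h1 : (1 - suppProj σ).PosSemidef := by
    have := posSemidef_self_mul_conjTranspose (1 - suppProj σ)
    rw [conjTranspose_sub, conjTranspose_one, hP] at this
    convert this using 1
    simp [mul_sub, sub_mul, hPP]
  have h2 : mpow σ (-(1 / 2)) * σ * mpow σ (-(1 / 2)) = suppProj σ := by
    nth_rewrite 2 [← mpow_half_mul_self hσ]
    rw [← mul_assoc, suppProj_comm hσ, mul_assoc, ← suppProj, hPP]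
  -- With `P` the support projection of `σ`, the target is `y (1 - P) + σ^{-1/2} (y σ - ρ)
  -- σ^{-1/2}`.
  have h3 := (h1.smul hy).add (mpow_sandwich_posSemidef h σ (-(1 / 2)))
  convert h3 using 1
  rw [mul_sub, sub_mul, Matrix.mul_smul, Matrix.smul_mul, h2, smul_sub]
  abel

/-- For `ρ ≪ σ` there is a common decomposition of `ρ` and `σ` into rank one matrices that computes
the geometric mean. -/
theorem exists_geomMean_decomposition [DecidableEq a] {ρ σ : Matrix a a ℂ} (hρ : ρ.PosSemidef)
    (hσ : σ.PosSemidef) (h : SuppLE ρ σ) (α : ℝ) :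
    ∃ (L : Matrix a a ℂ) (l : a → ℝ), (∀ i, 0 ≤ l i) ∧ σ = L * Lᴴ ∧
      ρ = L * diagonal (fun i => (l i : ℂ)) * Lᴴ ∧
      geomMean α σ ρ = L * diagonal (fun i => ((l i ^ α : ℝ) : ℂ)) * Lᴴ ∧
      ∀ y : ℝ, 0 ≤ y → (y • σ - ρ).PosSemidef → ∀ i, l i ≤ y := by
  have hC := mpow_sandwich_posSemidef hρ σ (-(1 / 2))
  have hs := h.sandwich hρ hσ
  obtain ⟨U, l, hl, hU', hU, hC', hpow⟩ := exists_spectral hC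
  -- `U` diagonalises `σ^{-1/2} ρ σ^{-1/2}` with eigenvalues `l`, so only the diagonal changes
  -- between `σ`, `ρ` and their geometric mean.
  refine ⟨mpow σ (1 / 2) * U, l, hl, ?_, ?_, ?_, ?_⟩
  · rw [conjTranspose_mul, mpow_herm, mul_assoc, ← mul_assoc U, hU, one_mul, mpow_half_mul_self hσ]
  · nth_rewrite 1 [← hs]
    rw [hC', conjTranspose_mul, mpow_herm]
    simp only [mul_assoc]
  · rw [geomMean, hpow, conjTranspose_mul, mpow_herm]
    simp only [mul_assoc]
  · intro y hy hle i
    have h1 := ((sandwich_le hσ hy hle).conjTranspose_mul_mul_same U).diag_nonneg (i := i)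
    have h2 : Uᴴ * (y • (1 : Matrix a a ℂ) - mpow σ (-(1 / 2)) * ρ * mpow σ (-(1 / 2))) * U =
        y • (1 : Matrix a a ℂ) - diagonal (fun i => (l i : ℂ)) := by
      rw [hC', mul_sub, sub_mul, Matrix.mul_smul, Matrix.smul_mul, mul_one, hU']
      congr 1
      calc _ = Uᴴ * U * diagonal (fun i => (l i : ℂ)) * (Uᴴ * U) := by simp only [mul_assoc]
        _ = _ := by rw [hU', one_mul, mul_one]
    rw [h2, Matrix.sub_apply, Matrix.smul_apply, one_apply_eq, diagonal_apply_eq, Complex.real_smul, mul_one,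
      sub_nonneg] at h1
    exact_mod_cast h1

/-- The geometric mean is covariant under congruence by left-invertible matrices. -/
theorem geomMean_congruence [DecidableEq a] [DecidableEq b] {ρ σ : Matrix a a ℂ}
    (hρ : ρ.PosSemidef) (hσ : σ.PosSemidef) (h : SuppLE ρ σ) {K : Matrix b a ℂ}
    {K' : Matrix a b ℂ} (hK : K' * K = 1) {α : ℝ} (hα : 1 < α) :
    geomMean α (K * σ * Kᴴ) (K * ρ * Kᴴ) = K * geomMean α σ ρ * Kᴴ := by
  have hK2 : Kᴴ * K'ᴴ = 1 := by rw [← conjTranspose_mul, hK, conjTranspose_one]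
  have hτ : (K * σ * Kᴴ).PosSemidef := hσ.mul_mul_conjTranspose_same K
  have hC := mpow_sandwich_posSemidef hρ σ (-(1 / 2))
  have hsand := h.sandwich hρ hσ
  have hss := mpow_half_mul_self hσ
  obtain ⟨-, -, hsP⟩ := suppProj_facts hσ
  have hsc := suppProj_comm hσ
  have htc := suppProj_comm hτ
  obtain ⟨hQ, hτQ, htQ⟩ := suppProj_facts hτ
  set τ := K * σ * Kᴴ with hτdef
  set s := mpow σ (1 / 2) with hs
  set s' := mpow σ (-(1 / 2)) with hs'
  set t := mpow τ (1 / 2) with ht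
  set t' := mpow τ (-(1 / 2)) with ht'
  have hsH : sᴴ = s := mpow_herm _ _
  have htH : tᴴ = t := mpow_herm _ _
  have htH' : t'ᴴ = t' := mpow_herm _ _
  set C := s' * ρ * s' with hCdef
  have hKsQ : s * Kᴴ * suppProj τ = s * Kᴴ := by
    have h1 : (K * s) * (K * s)ᴴ * (1 - suppProj τ) = 0 := by
      have : (K * s) * (K * s)ᴴ = τ := by
        rw [conjTranspose_mul, hsH, hτdef, ← hss]; simp only [Matrix.mul_assoc]
      rw [this, mul_sub, mul_one, hτQ, sub_self]
    rw [self_mul_conjTranspose_mul_eq_zero, conjTranspose_mul, hsH, Matrix.mul_sub, Matrix.mul_one,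
      sub_eq_zero] at h1
    exact h1.symm
  -- `W` is the partial isometry of the polar decomposition `s * Kᴴ = W * t`; the left inverse of
  -- `K` ensures that `W * Wᴴ` is the identity on the support of `σ`.
  set W : Matrix a b ℂ := s * Kᴴ * t' with hW
  have hWH : Wᴴ = t' * K * s := by
    rw [hW]; simp only [conjTranspose_mul, conjTranspose_conjTranspose, hsH, htH', Matrix.mul_assoc]
  have hWWs : W * Wᴴ * s = s := by
    have htt : t' * t' * τ = suppProj τ := by
      nth_rewrite 1 [← mpow_half_mul_self hτ]
      calc _ = t' * (t' * t) * t := by simp only [mul_assoc]; rfl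
        _ = suppProj τ := by rw [htc, htQ, htc]
    calc W * Wᴴ * s = s * Kᴴ * (t' * t') * K * (s * s) * (Kᴴ * K'ᴴ) := by
          rw [hK2, hW, hWH]; simp only [Matrix.mul_assoc, Matrix.mul_one]
      _ = s * Kᴴ * (t' * t' * τ) * K'ᴴ := by rw [hss, hτdef]; simp only [Matrix.mul_assoc]
      _ = s := by rw [htt, hKsQ, Matrix.mul_assoc, hK2, Matrix.mul_one]
  have hsWW : s * (W * Wᴴ) = s := by
    have := congrArg conjTranspose hWWs
    simpa only [conjTranspose_mul, conjTranspose_conjTranspose, hsH] using this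
  have hCP : C * (s' * s) = C := by
    rw [hsc, hCdef, mul_assoc, hsP]
  have hCW : C * W * Wᴴ = C := by
    calc C * W * Wᴴ = C * (s' * s) * W * Wᴴ := by rw [hCP]
      _ = C * s' * (s * (W * Wᴴ)) := by simp only [Matrix.mul_assoc]
      _ = C := by rw [hsWW, mul_assoc, hCP]
  have hcomp : t' * (K * ρ * Kᴴ) * t' = Wᴴ * C * W := by
    rw [hWH, hW]
    nth_rewrite 1 [← hsand]
    simp only [Matrix.mul_assoc]
  have hWt : W * t = s * Kᴴ := by
    rw [hW, Matrix.mul_assoc, suppProj_comm hτ, hKsQ]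
  have hWt' : t * Wᴴ = K * s := by
    have := congrArg conjTranspose hWt
    simpa only [conjTranspose_mul, conjTranspose_conjTranspose, hsH, htH] using this
  calc geomMean α τ (K * ρ * Kᴴ) = t * mpow (t' * (K * ρ * Kᴴ) * t') α * t := rfl
    _ = (t * Wᴴ) * mpow C α * (W * t) := by
        rw [hcomp, mpow_compress hC hCW hα]; simp only [Matrix.mul_assoc]
    _ = K * geomMean α σ ρ * Kᴴ := by
        rw [hWt, hWt', geomMean, ← hs, ← hs', ← hCdef]; simp only [Matrix.mul_assoc]

end MatrixFacts

/-! ### Choi matrices and common Kraus decompositions -/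

section Maps

open Matrix
open scoped Kronecker

variable {a b c : Type}

/-- The linear map with a given Choi matrix. -/
def ofChoi [Fintype a] (J : Matrix (a × b) (a × b) ℂ) : OpMap a b where
  toFun X := Matrix.of fun p q => ∑ i, ∑ j, X i j * J (i, p) (j, q)
  map_add' X Y := by ext p q; simp [add_mul, Finset.sum_add_distrib]
  map_smul' c X := by ext p q; simp [mul_assoc, Finset.mul_sum]

theorem choi_ofChoi [Fintype a] [DecidableEq a] (J : Matrix (a × b) (a × b) ℂ) :
    choi (ofChoi J) = J := by
  ext ⟨i, p⟩ ⟨j, q⟩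
  simp only [choi, ofChoi, of_apply, LinearMap.coe_mk, AddHom.coe_mk, single_apply, ite_mul,
    one_mul, zero_mul]
  rw [Finset.sum_eq_single i, Finset.sum_eq_single j] <;> simp +contextual [eq_comm]

theorem ofChoi_choi [Fintype a] [DecidableEq a] (N : OpMap a b) : ofChoi (choi N) = N := by
  ext1 X
  ext p q
  conv_rhs => rw [matrix_eq_sum_single X]
  simp only [ofChoi, choi, of_apply, LinearMap.coe_mk, AddHom.coe_mk, map_sum, Matrix.sum_apply]
  refine Finset.sum_congr rfl fun i _ => Finset.sum_congr rfl fun j _ => ?_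
  rw [← mul_one (X i j), ← smul_eq_mul (X i j) 1, ← smul_single, map_smul]
  simp

theorem ofChoi_add [Fintype a] (J K : Matrix (a × b) (a × b) ℂ) :
    ofChoi (J + K) = ofChoi J + ofChoi K := by
  ext1 X; ext p q; simp [ofChoi, mul_add, Finset.sum_add_distrib]

theorem ofChoi_sub [Fintype a] (J K : Matrix (a × b) (a × b) ℂ) :
    ofChoi (J - K) = ofChoi J - ofChoi K := by
  ext1 X; ext p q; simp [ofChoi, mul_sub, Finset.sum_sub_distrib]

theorem trace_ofChoi [Fintype a] [Fintype b] (J : Matrix (a × b) (a × b) ℂ) (X : Matrix a a ℂ) :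
    (ofChoi J X).trace = (X * (traceRight J)ᵀ).trace := by
  simp only [ofChoi, trace, diag_apply, of_apply, LinearMap.coe_mk, AddHom.coe_mk, traceRight,
    mul_apply, transpose_apply, Finset.mul_sum]
  rw [Finset.sum_comm]
  exact Finset.sum_congr rfl fun i _ => Finset.sum_comm

theorem exists_mul_conjTranspose [Fintype a] {X : Matrix a a ℂ} (hX : X.PosSemidef) :
    ∃ B : Matrix a a ℂ, X = B * Bᴴ := by
  classical
  refine ⟨mpow X (1 / 2), ?_⟩
  rw [mpow_herm, mpow_half_mul_self hX]

theorem mul_diagonal_mul_conjTranspose [Fintype c] [DecidableEq c] (L : Matrix a c ℂ) (d : c → ℂ) :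
    L * diagonal d * Lᴴ = ∑ k, d k • vecMulVec (L.col k) (star (L.col k)) := by
  ext i j
  rw [mul_apply, Matrix.sum_apply]
  refine Finset.sum_congr rfl fun k _ => ?_
  rw [mul_diagonal, mul_comm (L i k), mul_assoc]
  rfl

theorem exists_sum_vecMulVec [Fintype a] {X : Matrix a a ℂ} (hX : X.PosSemidef) :
    ∃ u : a → a → ℂ, X = ∑ k, vecMulVec (u k) (star (u k)) := by
  classical
  obtain ⟨B, hB⟩ := exists_mul_conjTranspose hX
  refine ⟨fun k => B.col k, ?_⟩
  have := mul_diagonal_mul_conjTranspose B 1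
  simpa [hB] using this

theorem trace_mul_nonneg [Fintype a] {X Y : Matrix a a ℂ} (hX : X.PosSemidef)
    (hY : Y.PosSemidef) : 0 ≤ (X * Y).trace := by
  obtain ⟨B, rfl⟩ := exists_mul_conjTranspose hX
  rw [mul_assoc, trace_mul_comm]
  exact (hY.conjTranspose_mul_mul_same B).trace_nonneg

/-- The Kraus operators read off from a decomposition of a Choi matrix. -/
def krausOf [Fintype a] {κ : Type} (L : Matrix (a × b) κ ℂ) (k : κ) (v : a → ℂ) : b → ℂ :=
  fun p => ∑ i, v i * L (i, p) k

/-- Each column of `L` is a vectorised Kraus operator. One `L` with different diagonals `d` yields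
several maps with the same Kraus operators and different weights. -/
theorem ofChoi_vecMulVec [Fintype a] {κ : Type} [Fintype κ] [DecidableEq κ]
    (L : Matrix (a × b) κ ℂ) (d : κ → ℂ) (v w : a → ℂ) :
    ofChoi (L * diagonal d * Lᴴ) (vecMulVec v (star w)) =
      ∑ k, d k • vecMulVec (krausOf L k v) (star (krausOf L k w)) := by
  ext p q
  rw [mul_diagonal_mul_conjTranspose]
  simp only [ofChoi, of_apply, LinearMap.coe_mk, AddHom.coe_mk, krausOf, Matrix.sum_apply,
    vecMulVec_apply, Pi.star_apply, Matrix.smul_apply, smul_eq_mul, star_sum, star_mul',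
    Finset.mul_sum, Finset.sum_mul, col_apply]
  rw [Finset.sum_comm]
  symm
  rw [Finset.sum_comm]
  refine Finset.sum_congr rfl fun i _ => ?_
  rw [Finset.sum_comm]
  refine Finset.sum_congr rfl fun j _ => Finset.sum_congr rfl fun k _ => ?_
  ring

/-- Trace of a vector's rank one projector. -/
theorem trace_vecMulVec_star [Fintype a] (v : a → ℂ) :
    (vecMulVec v (star v)).trace = ((∑ i, ‖v i‖ ^ 2 : ℝ) : ℂ) := by
  simp [trace, vecMulVec_apply, Complex.mul_conj, Complex.normSq_eq_norm_sq]

/-- A common decomposition of `ρ` and `σ` into rank one matrices, of weights `μ` and one, with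
`∑ μ ^ α tr ≤ c`. -/
def RevTest [Fintype a] (α c : ℝ) (ρ σ : Matrix a a ℂ) : Prop :=
  ∃ (κ : Type) (_ : Fintype κ) (u : κ → a → ℂ) (μ : κ → ℝ), (∀ k, 0 ≤ μ k) ∧
    σ = ∑ k, vecMulVec (u k) (star (u k)) ∧
    ρ = ∑ k, (μ k : ℂ) • vecMulVec (u k) (star (u k)) ∧
    ∑ k, μ k ^ α * ∑ i, ‖u k i‖ ^ 2 ≤ c

/-- A common Kraus decomposition of `N` and `M`, of weights `μ` and one, with
`∑ μ ^ α ‖F v‖² ≤ c ‖v‖²`. -/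
def RevTestMap [Fintype a] [Fintype b] (α c : ℝ) (N M : OpMap a b) : Prop :=
  ∃ (κ : Type) (_ : Fintype κ) (F : κ → (a → ℂ) → b → ℂ) (μ : κ → ℝ), (∀ k, 0 ≤ μ k) ∧
    (∀ v w, M (vecMulVec v (star w)) = ∑ k, vecMulVec (F k v) (star (F k w))) ∧
    (∀ v w, N (vecMulVec v (star w)) = ∑ k, (μ k : ℂ) • vecMulVec (F k v) (star (F k w))) ∧
    ∀ v, ∑ k, μ k ^ α * ∑ i, ‖F k v i‖ ^ 2 ≤ c * ∑ i, ‖v i‖ ^ 2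

/-- The chain rule: Kraus operators are applied to the vectors, weights multiply, and `(l μ) ^ α = l
^ α μ ^ α` makes the constants multiply too. -/
theorem RevTestMap.apply [Fintype a] [Fintype b] {α c d : ℝ} {N M : OpMap a b}
    {ρ σ : Matrix a a ℂ} (h : RevTestMap α c N M) (hs : RevTest α d ρ σ) (hc : 0 ≤ c) :
    RevTest α (c * d) (N ρ) (M σ) := by
  obtain ⟨κ, _, F, l, hl, hM, hN, hF⟩ := h
  obtain ⟨τ, _, u, μ, hμ, rfl, rfl, hu⟩ := hs
  refine ⟨τ × κ, inferInstance, fun x => F x.2 (u x.1), fun x => l x.2 * μ x.1,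
    fun x => mul_nonneg (hl _) (hμ _), ?_, ?_, ?_⟩
  · simp only [map_sum, hM, Fintype.sum_prod_type]
  · simp only [map_sum, map_smul, hN, Fintype.sum_prod_type, Finset.smul_sum, smul_smul]
    push_cast
    simp only [mul_comm]
  · calc _ = ∑ j, μ j ^ α * ∑ k, l k ^ α * ∑ i, ‖F k (u j) i‖ ^ 2 := by
          rw [Fintype.sum_prod_type]
          refine Finset.sum_congr rfl fun j _ => ?_
          rw [Finset.mul_sum]
          refine Finset.sum_congr rfl fun k _ => ?_
          rw [Real.mul_rpow (hl _) (hμ _)]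
          ring
      _ ≤ ∑ j, μ j ^ α * (c * ∑ i, ‖u j i‖ ^ 2) :=
          Finset.sum_le_sum fun j _ =>
            mul_le_mul_of_nonneg_left (hF _) (Real.rpow_nonneg (hμ j) _)
      _ = c * ∑ j, μ j ^ α * ∑ i, ‖u j i‖ ^ 2 := by
          rw [Finset.mul_sum]
          exact Finset.sum_congr rfl fun j _ => by ring
      _ ≤ c * d := mul_le_mul_of_nonneg_left hu hc

/-- The Kraus operators act on each slice with fixed memory indices, and squared norms add over
slices, so memories do not change the constant. -/
theorem RevTestMap.onShared (x y : Type) [Fintype x] [Fintype y] {a₁ b₁ a₂ b₂ : Type} [Fintype a₁]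
    [Fintype b₁] [Fintype a₂] [Fintype b₂] {α c : ℝ} {N M : BiMap a₁ b₁ a₂ b₂}
    (h : RevTestMap α c N M) :
    RevTestMap α c (onShared x y N) (onShared x y M) := by
  obtain ⟨κ, _, F, l, hl, hM, hN, hF⟩ := h
  let sl (v : (x × a₁) × (y × b₁) → ℂ) (r : x) (s : y) : a₁ × b₁ → ℂ :=
    fun t => v ((r, t.1), (s, t.2))
  have hsub : ∀ v w (p q : (x × a₂) × (y × b₂)),
      (vecMulVec v (star w)).submatrix (fun s : a₁ × b₁ => ((p.1.1, s.1), (p.2.1, s.2)))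
        (fun s : a₁ × b₁ => ((q.1.1, s.1), (q.2.1, s.2))) =
      vecMulVec (sl v p.1.1 p.2.1) (star (sl w q.1.1 q.2.1)) := fun v w p q => rfl
  have hre : ∀ {s t : Type} [Fintype s] [Fintype t] (f : (x × s) × (y × t) → ℝ),
      ∑ p, f p = ∑ i, ∑ j, ∑ k : s × t, f ((i, k.1), (j, k.2)) := by
    intro s t _ _ f
    simp only [Fintype.sum_prod_type]
    exact Finset.sum_congr rfl fun i _ => Finset.sum_comm
  refine ⟨κ, inferInstance, fun k v p => F k (sl v p.1.1 p.2.1) (p.1.2, p.2.2), l, hl, ?_, ?_, ?_⟩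
  · intro v w
    ext p q
    simp only [BidirectionalCapacity.onShared, LinearMap.coe_mk, AddHom.coe_mk, of_apply, hsub,
      hM, Matrix.sum_apply]
    rfl
  · intro v w
    ext p q
    simp only [BidirectionalCapacity.onShared, LinearMap.coe_mk, AddHom.coe_mk, of_apply, hsub,
      hN, Matrix.sum_apply]
    rfl
  · intro v
    rw [hre]
    calc _ = ∑ i, ∑ j, ∑ k, l k ^ α * ∑ p, ‖F k (sl v i j) p‖ ^ 2 := by
          simp only [hre, Finset.mul_sum]
          rw [Finset.sum_comm]
          refine Finset.sum_congr rfl fun i _ => ?_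
          rw [Finset.sum_comm]
      _ ≤ ∑ i, ∑ j, c * ∑ t, ‖sl v i j t‖ ^ 2 :=
          Finset.sum_le_sum fun i _ => Finset.sum_le_sum fun j _ => hF _
      _ = _ := by simp only [Finset.mul_sum, sl]

/-! ### Complete positivity -/

theorem IsCP.idTensor_posSemidef {N : OpMap a b} (hN : IsCP N) {r : Type} [Fintype r]
    {X : Matrix (r × a) (r × a) ℂ} (hX : X.PosSemidef) : (idTensor r N X).PosSemidef := by
  let e := Fintype.equivFin r
  have h := hN (Fintype.card r) _ (hX.submatrix (fun p : Fin (Fintype.card r) × a => (e.symm p.1, p.2)))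
  have h2 := h.submatrix (fun p : r × b => (e p.1, p.2))
  convert h2 using 1
  ext p q
  simp only [idTensor, LinearMap.coe_mk, AddHom.coe_mk, of_apply, submatrix_apply]
  refine congrFun (congrFun (congrArg N ?_) _) _
  ext i j
  simp

theorem IsCP.posSemidef {N : OpMap a b} (hN : IsCP N) {X : Matrix a a ℂ} (hX : X.PosSemidef) :
    (N X).PosSemidef :=
  (hN.idTensor_posSemidef (r := Unit) (hX.submatrix Prod.snd)).submatrix (fun p => ((), p))

theorem IsCP.choi_posSemidef [Fintype a] [DecidableEq a] {N : OpMap a b} (hN : IsCP N) :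
    (choi N).PosSemidef := by
  have h := hN.idTensor_posSemidef (r := a)
    (posSemidef_vecMulVec_self_star (fun p : a × a => if p.1 = p.2 then (1 : ℂ) else 0))
  convert h using 1
  ext p q
  simp only [choi, idTensor, LinearMap.coe_mk, AddHom.coe_mk, of_apply]
  refine congrFun (congrFun (congrArg N ?_) _) _
  ext i j
  simp only [single_apply, submatrix_apply, vecMulVec_apply, Pi.star_apply]
  split_ifs <;> simp_all

theorem isCP_ofChoi [Fintype a] [Fintype b] {J : Matrix (a × b) (a × b) ℂ} (hJ : J.PosSemidef) :
    IsCP (ofChoi J) := by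
  classical
  intro n X hX
  obtain ⟨B, rfl⟩ := exists_mul_conjTranspose hJ
  obtain ⟨u, rfl⟩ := exists_sum_vecMulVec hX
  have hv := ofChoi_vecMulVec B 1
  simp only [show (diagonal 1 : Matrix (a × b) (a × b) ℂ) = 1 from diagonal_one, mul_one,
    Pi.one_apply, one_smul] at hv
  rw [map_sum]
  refine posSemidef_sum _ fun j _ => ?_
  have : idTensor (Fin n) (ofChoi (B * Bᴴ)) (vecMulVec (u j) (star (u j))) =
      ∑ k, vecMulVec (fun p : Fin n × b => krausOf B k (fun i => u j (p.1, i)) p.2)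
        (star fun p : Fin n × b => krausOf B k (fun i => u j (p.1, i)) p.2) := by
    ext p q
    have h2 : (vecMulVec (u j) (star (u j))).submatrix (Prod.mk p.1) (Prod.mk q.1) =
      vecMulVec (fun i => u j (p.1, i)) (star fun i => u j (q.1, i)) := rfl
    simp only [idTensor, LinearMap.coe_mk, AddHom.coe_mk, of_apply, h2, hv, Matrix.sum_apply]
    rfl
  rw [this]
  exact posSemidef_sum _ fun k _ => posSemidef_vecMulVec_self_star _

theorem IsCP.onShared_posSemidef {x y : Type} [Fintype x] [Fintype y] {a₁ b₁ a₂ b₂ : Type}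
    {N : BiMap a₁ b₁ a₂ b₂} (hN : IsCP N) {X : Matrix ((x × a₁) × (y × b₁)) ((x × a₁) × (y × b₁)) ℂ}
    (hX : X.PosSemidef) : (BidirectionalCapacity.onShared x y N X).PosSemidef :=
  (hN.idTensor_posSemidef (r := x × y)
    (hX.submatrix fun p : (x × y) × (a₁ × b₁) => ((p.1.1, p.2.1), (p.1.2, p.2.2)))).submatrix
      fun p : (x × a₂) × (y × b₂) => ((p.1.1, p.2.1), (p.1.2, p.2.2))

/-- All weights are one: a free operation applied in both protocols costs nothing. -/
theorem IsChannel.revTestMap [Fintype a] [Fintype b] {N : OpMap a b} (hN : IsChannel N) (α : ℝ) :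
    RevTestMap α 1 N N := by
  classical
  obtain ⟨B, hB⟩ := exists_mul_conjTranspose hN.1.choi_posSemidef
  have hv := ofChoi_vecMulVec B 1
  simp only [show (diagonal 1 : Matrix (a × b) (a × b) ℂ) = 1 from diagonal_one, mul_one,
    Pi.one_apply, one_smul, ← hB, ofChoi_choi] at hv
  refine ⟨a × b, inferInstance, krausOf B, 1, fun _ => zero_le_one, hv, fun v w => by simp [hv], ?_⟩
  intro v
  have h1 := hN.2 (vecMulVec v (star v))
  rw [hv, trace_sum, trace_vecMulVec_star] at h1
  simp only [trace_vecMulVec_star] at h1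
  have h2 : ∑ k, ∑ i, ‖krausOf B k v i‖ ^ 2 = ∑ i, ‖v i‖ ^ 2 := by exact_mod_cast h1
  simp [h2]

end Maps

/-! ### From the channel divergence to a common Kraus decomposition -/

section ChannelDivergence

open Matrix
open scoped Kronecker

variable {a b r : Type} [Fintype a] [Fintype b] [Fintype r] [DecidableEq a] [DecidableEq b]

omit [Fintype r] in
theorem idTensor_vecMulVec (N : OpMap a b) (ψ : r × a → ℂ) :
    idTensor r N (vecMulVec ψ (star ψ)) =
      ((of fun s i => ψ (s, i)) ⊗ₖ (1 : Matrix b b ℂ)) * choi N *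
        ((of fun s i => ψ (s, i)) ⊗ₖ (1 : Matrix b b ℂ))ᴴ := by
  ext p q
  have h : (vecMulVec ψ (star ψ)).submatrix (Prod.mk p.1) (Prod.mk q.1) =
      vecMulVec (fun i => ψ (p.1, i)) (star fun i => ψ (q.1, i)) := rfl
  simp only [idTensor, LinearMap.coe_mk, AddHom.coe_mk, of_apply, h]
  conv_lhs => rw [← ofChoi_choi N]
  simp only [ofChoi, of_apply, LinearMap.coe_mk, AddHom.coe_mk, mul_apply, kroneckerMap_apply,
    conjTranspose_apply, Fintype.sum_prod_type, one_apply, vecMulVec_apply, Pi.star_apply]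
  simp only [mul_ite, mul_one, mul_zero, ite_mul, zero_mul, Finset.sum_ite_eq, Finset.mem_univ,
    if_true, apply_ite star, star_zero, Finset.sum_mul]
  rw [Finset.sum_comm]
  exact Finset.sum_congr rfl fun i _ => Finset.sum_congr rfl fun j _ => by ring

omit [DecidableEq a] [DecidableEq b] [Fintype a] in
theorem trace_idTensor (N : OpMap a b) (X : Matrix (r × a) (r × a) ℂ) :
    (idTensor r N X).trace = (N (∑ s, X.submatrix (Prod.mk s) (Prod.mk s))).trace := by
  rw [map_sum, trace_sum]
  simp [trace, idTensor, Fintype.sum_prod_type]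

/-- A bound on the channel divergence bounds the trace of the map with Choi matrix
`G_α(J_M, J_N)` on every positive definite density matrix. -/
theorem trace_geomMean_of_divergence_le [Nonempty a] {N M : OpMap a b} (hN : IsCP N) (hM : IsCP M)
    {α t : ℝ} (hα : 1 < α) (h : geomChannelDiv α N M ≤ (t : EReal)) {A : Matrix a a ℂ}
    (hA : A.PosDef) (hA1 : A.trace = 1) :
    SuppLE (choi N) (choi M) ∧
      (ofChoi (geomMean α (choi M) (choi N)) A).trace.re ≤ 2 ^ ((α - 1) * t) := by
  let e := Fintype.equivFin a
  set S := mpow A (1 / 2) with hS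
  set S' := mpow A (-(1 / 2)) with hS'
  have hSS : S * S = A := mpow_half_mul_self hA.posSemidef
  have hSS' : S * S' = 1 := by
    rw [hS, hS', mpow_mul_mpow hA, add_neg_cancel, mpow_at_zero hA]
  have hSH : Sᴴ = S := mpow_herm _ _
  -- `ψ` is the canonical purification of `A`, the vectorised `A^{1/2}` with the reference
  -- relabelled by `e`. Positive definiteness of `A` makes the matrix `K` of `ψ` left invertible, so
  -- that the output determines the Choi matrix.
  let ψ : Fin (Fintype.card a) × a → ℂ := fun p => S p.2 (e.symm p.1)
  let K : Matrix (Fin (Fintype.card a)) a ℂ := of fun s i => ψ (s, i)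
  let K' : Matrix a (Fin (Fintype.card a)) ℂ := of fun i s => S' (e.symm s) i
  have hK : K' * K = 1 := by
    ext i j
    have h1 := congrFun (congrFun hSS' j) i
    simp only [mul_apply, one_apply] at h1
    simp only [mul_apply, K, K', ψ, of_apply, one_apply]
    rw [e.symm.sum_comp (fun s => S' s i * S j s)]
    simp only [mul_comm (S' _ i), h1, eq_comm]
  have hK1 : (K' ⊗ₖ (1 : Matrix b b ℂ)) * (K ⊗ₖ (1 : Matrix b b ℂ)) = 1 := by
    rw [← mul_kronecker_mul, hK, one_mul, one_kronecker_one]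
  have hred : ∑ s, (vecMulVec ψ (star ψ)).submatrix (Prod.mk s) (Prod.mk s) = A := by
    ext i j
    rw [Matrix.sum_apply]
    simp only [submatrix_apply, vecMulVec_apply, Pi.star_apply, ψ]
    rw [e.symm.sum_comp (fun s => S i s * star (S j s)), ← hSS]
    nth_rewrite 4 [← hSH]
    rfl
  have hψ : ∑ i, ‖ψ i‖ ^ 2 = 1 := by
    have h1 : (vecMulVec ψ (star ψ)).trace = 1 := by
      rw [← hA1, ← hred, trace_sum]
      simp [trace, Fintype.sum_prod_type]
    rw [trace_vecMulVec_star] at h1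
    exact_mod_cast h1
  have hd : geomDiv α (idTensor _ N (vecMulVec ψ (star ψ))) (idTensor _ M (vecMulVec ψ (star ψ))) ≤
      (t : EReal) := by
    refine le_trans ?_ h
    exact le_iSup_of_le (Fintype.card a) (le_iSup_of_le ψ (le_iSup_of_le hψ le_rfl))
  rw [idTensor_vecMulVec, idTensor_vecMulVec, geomDiv] at hd
  split_ifs at hd with hs
  · have hsupp := suppLE_of_mul_mul_conjTranspose hK1 hs
    refine ⟨hsupp, ?_⟩
    rw [geomMean_congruence hN.choi_posSemidef hM.choi_posSemidef hsupp hK1 hα] at hd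
    rw [← choi_ofChoi (geomMean α (choi M) (choi N)), ← idTensor_vecMulVec, trace_idTensor, hred,
      EReal.coe_le_coe_iff, inv_mul_le_iff₀ (by linarith)] at hd
    set q := (ofChoi (geomMean α (choi M) (choi N)) A).trace.re
    -- The logarithm carries information only for positive `q`; otherwise the bound holds because
    -- the right side is positive.
    rcases le_or_gt q 0 with hq | hq
    · exact hq.trans (by positivity)
    · exact (Real.logb_le_iff_le_rpow one_lt_two hq).1 hd
  · exact absurd hd (by simp)

/-- The trace bound on positive definite densities extends by scaling to all positive definite `A`,
then by a limit to semidefinite ones. At `A = |v⟩⟨v|` it is the required inequality for the Kraus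
operators that diagonalise both Choi matrices. -/
theorem RevTestMap.of_geomChannelDiv_le [Nonempty a] {N M : OpMap a b} (hN : IsCP N) (hM : IsCP M)
    {α t : ℝ} (hα : 1 < α) (h : geomChannelDiv α N M ≤ (t : EReal)) :
    RevTestMap α (2 ^ ((α - 1) * t)) N M := by
  set c : ℝ := 2 ^ ((α - 1) * t) with hc
  set G := geomMean α (choi M) (choi N) with hG
  have hcard : (Fintype.card a : ℂ) ≠ 0 := by simp
  have key := fun A hA hA1 => trace_geomMean_of_divergence_le hN hM hα h (A := A) hA hA1
  have hnorm : ∀ A : Matrix a a ℂ, A.PosDef → SuppLE (choi N) (choi M) ∧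
      (ofChoi G A).trace.re ≤ c * A.trace.re := by
    intro A hA
    have ht := hA.trace_pos
    obtain ⟨ht1, ht2⟩ := Complex.pos_iff.1 ht
    have htr : (A.trace.re : ℂ) = A.trace := Complex.ext rfl ht2
    have h1 := key (((A.trace.re)⁻¹ : ℝ) • A) (hA.smul (inv_pos.2 ht1)) (by
      rw [trace_smul, Complex.real_smul, ← htr]
      push_cast
      rw [Complex.ofReal_re, inv_mul_cancel₀]
      exact_mod_cast ht1.ne')
    refine ⟨h1.1, ?_⟩
    have h2 := h1.2
    rw [← Complex.coe_smul, map_smul, trace_smul, smul_eq_mul, Complex.re_ofReal_mul,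
      inv_mul_le_iff₀ ht1, mul_comm] at h2
    exact h2
  have hsupp := (hnorm 1 PosDef.one).1
  have hpsd : ∀ A : Matrix a a ℂ, A.PosSemidef → (ofChoi G A).trace.re ≤ c * A.trace.re := by
    intro A hA
    have h1 : ∀ η : ℝ, 0 < η → (ofChoi G A).trace.re + η * (ofChoi G 1).trace.re ≤
        c * (A.trace.re + η * (1 : Matrix a a ℂ).trace.re) := by
      intro η hη
      have h2 := (hnorm (A + η • 1) (PosDef.posSemidef_add hA (PosDef.one.smul hη))).2
      rw [← Complex.coe_smul, map_add, map_smul] at h2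
      simpa only [trace_add, trace_smul, smul_eq_mul, Complex.add_re, Complex.re_ofReal_mul] using h2
    have hl : Filter.Tendsto (fun η : ℝ => (ofChoi G A).trace.re + η * (ofChoi G 1).trace.re)
        (nhdsWithin 0 (Set.Ioi 0)) (nhds ((ofChoi G A).trace.re + 0 * (ofChoi G 1).trace.re)) :=
      ((by fun_prop : Continuous fun η : ℝ =>
        (ofChoi G A).trace.re + η * (ofChoi G 1).trace.re).tendsto 0).mono_left nhdsWithin_le_nhds
    have hr : Filter.Tendsto (fun η : ℝ => c * (A.trace.re + η * (1 : Matrix a a ℂ).trace.re))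
        (nhdsWithin 0 (Set.Ioi 0)) (nhds (c * (A.trace.re + 0 * (1 : Matrix a a ℂ).trace.re))) :=
      ((by fun_prop : Continuous fun η : ℝ =>
        c * (A.trace.re + η * (1 : Matrix a a ℂ).trace.re)).tendsto 0).mono_left nhdsWithin_le_nhds
    simpa only [zero_mul, add_zero] using le_of_tendsto_of_tendsto hl hr
      (Filter.eventually_of_mem self_mem_nhdsWithin h1)
  obtain ⟨L, l, hl, hσ, hρ, hGL, -⟩ := exists_geomMean_decomposition hN.choi_posSemidef
    hM.choi_posSemidef hsupp α
  refine ⟨a × b, inferInstance, krausOf L, l, hl, ?_, ?_, ?_⟩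
  · intro v w
    have hv := ofChoi_vecMulVec L 1 v w
    simp only [show (diagonal 1 : Matrix (a × b) (a × b) ℂ) = 1 from diagonal_one, mul_one,
      Pi.one_apply, one_smul, ← hσ, ofChoi_choi] at hv
    exact hv
  · intro v w
    rw [← ofChoi_vecMulVec, ← hρ, ofChoi_choi]
  · intro v
    have h1 := hpsd _ (posSemidef_vecMulVec_self_star v)
    rw [hG, hGL, ofChoi_vecMulVec, trace_vecMulVec_star, trace_sum] at h1
    simp only [trace_smul, trace_vecMulVec_star, smul_eq_mul] at h1
    exact_mod_cast h1

end ChannelDivergence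

/-! ### Partial transposition -/

section PartialTranspose

open Matrix

variable {a b a₁ b₁ a₂ b₂ x y : Type}

theorem trace_transposeBob [Fintype a] [Fintype b] (X : Matrix (a × b) (a × b) ℂ) :
    (transposeBob a b X).trace = X.trace := rfl

theorem transposeBob_one [DecidableEq a] [DecidableEq b] :
    transposeBob a b (1 : Matrix (a × b) (a × b) ℂ) = 1 := by
  ext ⟨i, j⟩ ⟨k, l⟩
  simp only [transposeBob, LinearMap.coe_mk, AddHom.coe_mk, of_apply, one_apply, Prod.mk.injEq]
  exact if_congr (and_congr_right fun _ => eq_comm) rfl rfl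

/-- Turns the Choi matrix condition of the Theta set into one on the map `T ∘ M ∘ T`. -/
theorem choi_transposeBob_conj [DecidableEq a₁] [DecidableEq b₁] (M : BiMap a₁ b₁ a₂ b₂) :
    choi (transposeBob a₂ b₂ ∘ₗ M ∘ₗ transposeBob a₁ b₁) = choiTransposeBob (choi M) := by
  ext p q
  have h : transposeBob a₁ b₁ (single p.1 q.1 1) =
      single (p.1.1, q.1.2) (q.1.1, p.1.2) (1 : ℂ) := by
    ext s t
    simp only [transposeBob, LinearMap.coe_mk, AddHom.coe_mk, of_apply, single_apply, Prod.ext_iff]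
    exact if_congr (by tauto) rfl rfl
  change M (transposeBob a₁ b₁ (single p.1 q.1 1)) _ _ = _
  rw [h]
  rfl

theorem transposeBob_onShared (M : BiMap a₁ b₁ a₂ b₂)
    (X : Matrix ((x × a₁) × (y × b₁)) ((x × a₁) × (y × b₁)) ℂ) :
    transposeBob _ _ (onShared x y M X) =
      onShared x y (transposeBob a₂ b₂ ∘ₗ M ∘ₗ transposeBob a₁ b₁) (transposeBob _ _ X) := rfl

theorem onShared_add (M N : BiMap a₁ b₁ a₂ b₂) :
    onShared x y (M + N) = onShared x y M + onShared x y N := rfl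

theorem onShared_sub (M N : BiMap a₁ b₁ a₂ b₂) :
    onShared x y (M - N) = onShared x y M - onShared x y N := rfl

theorem trace_onShared [Fintype x] [Fintype y] [Fintype a₁] [Fintype b₁] [Fintype a₂] [Fintype b₂]
    (M : BiMap a₁ b₁ a₂ b₂) (X : Matrix ((x × a₁) × (y × b₁)) ((x × a₁) × (y × b₁)) ℂ) :
    (onShared x y M X).trace = ∑ i, ∑ j, (M (X.submatrix (fun s => ((i, s.1), (j, s.2)))
      (fun s => ((i, s.1), (j, s.2))))).trace := by
  simp only [trace, diag_apply, Fintype.sum_prod_type, onShared, LinearMap.coe_mk, AddHom.coe_mk,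
    of_apply]
  exact Finset.sum_congr rfl fun i _ => Finset.sum_comm

theorem traceRight_posSemidef [Fintype b] {X : Matrix (a × b) (a × b) ℂ} (hX : X.PosSemidef) :
    (traceRight X).PosSemidef := by
  have : traceRight X = ∑ k, X.submatrix (fun i => (i, k)) (fun i => (i, k)) := by
    ext i j
    simp [traceRight, Matrix.sum_apply]
  rw [this]
  exact posSemidef_sum _ fun k _ => hX.submatrix _

theorem trace_traceRight [Fintype a] [Fintype b] (X : Matrix (a × b) (a × b) ℂ) :
    (traceRight X).trace = X.trace := by
  simp [trace, traceRight, Fintype.sum_prod_type]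

/-- The trace norm of the partial transpose of `σ` is at most one, in the form `± σ^T ≤ R` with
`tr R ≤ 1`. -/
def TransposeBounded [Fintype a] [Fintype b] (σ : Matrix (a × b) (a × b) ℂ) : Prop :=
  ∃ R : Matrix (a × b) (a × b) ℂ, (R + transposeBob a b σ).PosSemidef ∧
    (R - transposeBob a b σ).PosSemidef ∧ R.trace.re ≤ 1

theorem half_add_sub_posSemidef {R S : Matrix a a ℂ} (h₁ : (R + S).PosSemidef)
    (h₂ : (R - S).PosSemidef) : R.PosSemidef := by
  have h := (h₁.add h₂).smul (show (0 : ℝ) ≤ 1 / 2 by norm_num)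
  convert h using 1
  rw [add_add_sub_cancel, ← two_smul ℝ, smul_smul]
  norm_num

/-- The map `T ∘ P ∘ T` is positive and trace preserving, so it carries a certificate `R` for `σ` to
one for `P σ`. -/
theorem PPT.transposeBounded [Fintype a₁] [Fintype b₁] [Fintype a₂] [Fintype b₂]
    {P : BiMap a₁ b₁ a₂ b₂} (hP : PPT P) {σ : Matrix (a₁ × b₁) (a₁ × b₁) ℂ}
    (hσ : TransposeBounded σ) : TransposeBounded (P σ) := by
  obtain ⟨R, h₁, h₂, ht⟩ := hσ
  refine ⟨(transposeBob a₂ b₂ ∘ₗ P ∘ₗ transposeBob a₁ b₁) R, ?_, ?_, ?_⟩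
  · have := hP.2.posSemidef h₁
    rw [map_add] at this
    exact this
  · have := hP.2.posSemidef h₂
    rw [map_sub] at this
    exact this
  · change (transposeBob a₂ b₂ (P (transposeBob a₁ b₁ R))).trace.re ≤ 1
    rwa [trace_transposeBob, hP.1.2, trace_transposeBob]

theorem trace_ofChoi_le [Fintype a] [Fintype b] [DecidableEq a] {R : Matrix (a × b) (a × b) ℂ}
    (h : (1 - traceRight R).PosSemidef) {X : Matrix a a ℂ} (hX : X.PosSemidef) :
    (ofChoi R X).trace.re ≤ X.trace.re := by
  have := trace_mul_nonneg hX h.transpose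
  rw [transpose_sub, transpose_one, mul_sub, mul_one, trace_sub, ← trace_ofChoi] at this
  have := (Complex.nonneg_iff.1 this).1
  rw [Complex.sub_re] at this
  linarith

theorem TransposeBounded.theta [Fintype a₁] [Fintype b₁] [Fintype a₂] [Fintype b₂] [DecidableEq a₁]
    [DecidableEq b₁] [Fintype x] [Fintype y] {M : BiMap a₁ b₁ a₂ b₂}
    (hM : M ∈ thetaSet a₁ b₁ a₂ b₂) {σ : Matrix ((x × a₁) × (y × b₁)) ((x × a₁) × (y × b₁)) ℂ}
    (hσ : TransposeBounded σ) : TransposeBounded (onShared x y M σ) := by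
  obtain ⟨-, R, hp, hm, hR⟩ := hM
  obtain ⟨Q, h₁, h₂, ht⟩ := hσ
  have hQ := half_add_sub_posSemidef h₁ h₂
  have hT : transposeBob _ _ (onShared x y M σ) =
      onShared x y (ofChoi (choiTransposeBob (choi M))) (transposeBob _ _ σ) := by
    rw [transposeBob_onShared, ← choi_transposeBob_conj, ofChoi_choi]
  -- Writing `J` for the transposed Choi matrix and matrices for the maps they define, `R(Q) + J(S)`
  -- is half of `(R + J)(Q + S) + (R - J)(Q - S)`, a sum of completely positive maps at positive
  -- arguments.
  have key : ∀ {S : Matrix ((x × a₁) × (y × b₁)) ((x × a₁) × (y × b₁)) ℂ},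
      (Q + S).PosSemidef → (Q - S).PosSemidef →
      (onShared x y (ofChoi R) Q +
        onShared x y (ofChoi (choiTransposeBob (choi M))) S).PosSemidef := by
    intro S hS₁ hS₂
    have e₁ := (isCP_ofChoi hp).onShared_posSemidef hS₁
    have e₂ := (isCP_ofChoi hm).onShared_posSemidef hS₂
    have h := (e₁.add e₂).smul (show (0 : ℝ) ≤ 1 / 2 by norm_num)
    convert h using 1
    rw [ofChoi_add, ofChoi_sub, onShared_add, onShared_sub]
    simp only [LinearMap.add_apply, LinearMap.sub_apply, map_add, map_sub]
    module
  refine ⟨onShared x y (ofChoi R) Q, ?_, ?_, ?_⟩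
  · rw [hT]
    exact key h₁ h₂
  · rw [hT, sub_eq_add_neg, ← map_neg]
    exact key (by rwa [← sub_eq_add_neg]) (by rwa [sub_neg_eq_add])
  · refine le_trans ?_ ht
    have hid : Q.trace = ∑ i, ∑ j, (Q.submatrix (fun s : a₁ × b₁ => ((i, s.1), (j, s.2)))
        (fun s => ((i, s.1), (j, s.2)))).trace := trace_onShared LinearMap.id Q
    rw [trace_onShared, hid]
    simp only [Complex.re_sum]
    exact Finset.sum_le_sum fun i _ => Finset.sum_le_sum fun j _ =>
      trace_ofChoi_le hR (hQ.submatrix _)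

end PartialTranspose

/-! ### The maximally entangled state -/

section MaxEnt

open Matrix

variable {m : ℕ}

theorem maxEnt_conjTranspose : (maxEnt m)ᴴ = maxEnt m := by
  ext p q
  simp only [maxEnt, conjTranspose_apply, of_apply, and_comm]
  split_ifs <;> simp

theorem maxEnt_mul_self : maxEnt m * maxEnt m = maxEnt m := by
  ext p q
  have hm : (m : ℂ) ≠ 0 := by
    have := p.1.pos
    exact_mod_cast this.ne'
  simp only [maxEnt, mul_apply, of_apply, Fintype.sum_prod_type]
  by_cases h₁ : p.1 = p.2 <;> by_cases h₂ : q.1 = q.2 <;> simp [h₁, h₂, hm]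

theorem maxEnt_posSemidef : (maxEnt m).PosSemidef := by
  have := posSemidef_self_mul_conjTranspose (maxEnt m)
  rwa [maxEnt_conjTranspose, maxEnt_mul_self] at this

theorem one_sub_maxEnt_posSemidef : (1 - maxEnt m).PosSemidef := by
  have := posSemidef_self_mul_conjTranspose (1 - maxEnt m)
  rw [conjTranspose_sub, conjTranspose_one, maxEnt_conjTranspose] at this
  convert this using 1
  simp [mul_sub, sub_mul, maxEnt_mul_self]

/-- The overlap of the maximally entangled state with `σ` is at most `‖σ^T‖₁ / m`. -/
theorem TransposeBounded.trace_maxEnt_le {σ : Matrix (Fin m × Fin m) (Fin m × Fin m) ℂ}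
    (hσ : TransposeBounded σ) : (maxEnt m * σ).trace.re ≤ 1 / m := by
  obtain ⟨R, h₁, h₂, ht⟩ := hσ
  set S := transposeBob (Fin m) (Fin m) σ with hS
  -- The swap operator `F` is `m` times the partial transpose of `Φ_m`, so `tr (Φ_m σ) = tr (F S) /
  -- m`; what remains is `-1 ≤ F ≤ 1`.
  let F : Matrix (Fin m × Fin m) (Fin m × Fin m) ℂ := (1 : Matrix _ _ ℂ).submatrix Prod.swap id
  have hmul : ∀ X : Matrix (Fin m × Fin m) (Fin m × Fin m) ℂ, F * X = X.submatrix Prod.swap id := by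
    intro X
    ext p q
    simp [F, mul_apply, one_apply]
  have hFH : Fᴴ = F := by
    ext p q
    simp only [F, conjTranspose_apply, submatrix_apply, one_apply, id, apply_ite star, star_one,
      star_zero]
    refine if_congr ⟨?_, ?_⟩ rfl rfl <;> rintro rfl <;> simp
  have hFF : F * F = 1 := by
    rw [hmul]
    ext p q
    change (1 : Matrix _ _ ℂ) p.swap.swap q = _
    rw [Prod.swap_swap]
  -- As `F ^ 2 = 1`, the square of `1 ± F` is twice itself.
  have hp : ((1 + F) + (1 + F)).PosSemidef := by
    have := posSemidef_self_mul_conjTranspose (1 + F)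
    rw [conjTranspose_add, conjTranspose_one, hFH] at this
    convert this using 1
    rw [add_mul, mul_add, mul_add, hFF, one_mul, one_mul, mul_one]
    abel
  have hm : ((1 - F) + (1 - F)).PosSemidef := by
    have := posSemidef_self_mul_conjTranspose (1 - F)
    rw [conjTranspose_sub, conjTranspose_one, hFH] at this
    convert this using 1
    rw [sub_mul, mul_sub, mul_sub, hFF, one_mul, one_mul, mul_one]
    abel
  -- In the sum of `(1 + F)(R - S)` and `(1 - F)(R + S)` all but `2 R - 2 F S` cancels.
  have e₁ := (Complex.nonneg_iff.1 (trace_mul_nonneg hp h₂)).1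
  have e₂ := (Complex.nonneg_iff.1 (trace_mul_nonneg hm h₁)).1
  have hFS : (F * S).trace.re ≤ 1 := by
    simp only [add_mul, sub_mul, mul_add, mul_sub, one_mul, trace_add, trace_sub, Complex.add_re,
      Complex.sub_re] at e₁ e₂
    linarith
  have hE : (maxEnt m * σ).trace = (1 / m : ℂ) * (F * S).trace := by
    rw [hmul, hS]
    simp only [maxEnt, transposeBob, trace, diag_apply, mul_apply, of_apply, Fintype.sum_prod_type,
      LinearMap.coe_mk, AddHom.coe_mk, submatrix_apply, Prod.swap, id, Finset.mul_sum]
    refine Finset.sum_congr rfl fun i _ => ?_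
    rw [Finset.sum_eq_single i]
    · simp
    · intro j _ hj
      simp [hj.symm]
    · simp
  rw [hE, show (1 / m : ℂ) = ((1 / m : ℝ) : ℂ) by push_cast; rfl, Complex.re_ofReal_mul]
  exact mul_le_of_le_one_right (by positivity) hFS

/-- Weighted Hölder for `∑ q_k μ_k` with `q_k = ⟨u_k|Φ_m|u_k⟩`; since `Φ_m ≤ 1`, `q_k ≤ ‖u_k‖²` and
the `α`-moment is at most `c`. -/
theorem RevTest.trace_maxEnt_le {α c : ℝ} (hα : 1 < α)
    {ρ σ : Matrix (Fin m × Fin m) (Fin m × Fin m) ℂ} (h : RevTest α c ρ σ) :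
    0 ≤ (maxEnt m * σ).trace.re ∧
    (maxEnt m * ρ).trace.re ≤ (maxEnt m * σ).trace.re ^ (1 - α⁻¹) * c ^ α⁻¹ := by
  obtain ⟨κ, _, u, μ, hμ, rfl, rfl, hu⟩ := h
  let q : κ → ℝ := fun k => (maxEnt m * vecMulVec (u k) (star (u k))).trace.re
  have hq0 : ∀ k, 0 ≤ q k := fun k =>
    (Complex.nonneg_iff.1 (trace_mul_nonneg maxEnt_posSemidef (posSemidef_vecMulVec_self_star _))).1
  have hq1 : ∀ k, q k ≤ ∑ i, ‖u k i‖ ^ 2 := by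
    intro k
    have := (Complex.nonneg_iff.1 (trace_mul_nonneg (one_sub_maxEnt_posSemidef (m := m))
      (posSemidef_vecMulVec_self_star (u k)))).1
    rw [sub_mul, one_mul, trace_sub, trace_vecMulVec_star, Complex.sub_re, Complex.ofReal_re] at this
    exact sub_nonneg.1 this
  have e₁ : (maxEnt m * ∑ k, vecMulVec (u k) (star (u k))).trace.re = ∑ k, q k := by
    rw [Finset.mul_sum, trace_sum, Complex.re_sum]
  have e₂ : (maxEnt m * ∑ k, (μ k : ℂ) • vecMulVec (u k) (star (u k))).trace.re =
      ∑ k, q k * μ k := by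
    rw [Finset.mul_sum, trace_sum, Complex.re_sum]
    refine Finset.sum_congr rfl fun k _ => ?_
    rw [Matrix.mul_smul, trace_smul, smul_eq_mul, Complex.re_ofReal_mul, mul_comm]
  rw [e₁, e₂]
  refine ⟨Finset.sum_nonneg fun k _ => hq0 k, ?_⟩
  refine (Real.inner_le_weight_mul_Lp_of_nonneg _ hα.le q μ hq0 hμ).trans ?_
  have hα0 : 0 ≤ α⁻¹ := inv_nonneg.2 (by linarith)
  refine mul_le_mul_of_nonneg_left (Real.rpow_le_rpow ?_ ?_ hα0)
    (Real.rpow_nonneg (Finset.sum_nonneg fun k _ => hq0 k) _)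
  · exact Finset.sum_nonneg fun k _ => mul_nonneg (hq0 k) (Real.rpow_nonneg (hμ k) _)
  · refine le_trans (Finset.sum_le_sum fun k _ => ?_) hu
    rw [mul_comm]
    exact mul_le_mul_of_nonneg_left (hq1 k) (Real.rpow_nonneg (hμ k) _)

end MaxEnt

/-! ### The strong converse for PPT-assisted protocols -/

section StrongConverse

open Matrix

variable {a₁ b₁ a₂ b₂ : Type} [Fintype a₁] [Fintype b₁] [Fintype a₂] [Fintype b₂]

/-- The witness `σ` is the output of the same protocol with each use of `N` replaced by `M`. -/
theorem Prepares.exists_comparison [DecidableEq a₁] [DecidableEq b₁] {N M : BiMap a₁ b₁ a₂ b₂}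
    {α c : ℝ} (hc : 0 ≤ c) (hNM : RevTestMap α c N M) (hM : M ∈ thetaSet a₁ b₁ a₂ b₂)
    {n : ℕ} {a b : Type} [Fintype a] [Fintype b] {ω : Matrix (a × b) (a × b) ℂ}
    (h : Prepares PPT N n a b ω) :
    ∃ σ, RevTest α (c ^ n) ω σ ∧ TransposeBounded σ := by
  induction h with
  | start a b P hP =>
    refine ⟨P 1, ?_, hP.transposeBounded ⟨1, ?_, ?_, ?_⟩⟩
    · have h1 : RevTest α 1 (1 : Matrix (Unit × Unit) (Unit × Unit) ℂ) 1 := by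
        refine ⟨Unit, inferInstance, fun _ _ => 1, 1, fun _ => zero_le_one, ?_, ?_, ?_⟩
        · ext p q
          rw [Subsingleton.elim p q]
          simp [vecMulVec_apply]
        · ext p q
          rw [Subsingleton.elim p q]
          simp [vecMulVec_apply]
        · simp
      simpa using (hP.1.revTestMap α).apply h1 zero_le_one
    · rw [transposeBob_one]
      exact PosSemidef.one.add PosSemidef.one
    · rw [transposeBob_one, sub_self]
      exact PosSemidef.zero
    · simp
  | use n x y a b ρ hρ P hP ih =>
    obtain ⟨σ, hσ, hT⟩ := ih
    refine ⟨P (onShared x y M σ), ?_, hP.transposeBounded (hT.theta hM)⟩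
    have := (hP.1.revTestMap α).apply ((hNM.onShared x y).apply hσ hc) zero_le_one
    rwa [one_mul, ← pow_succ'] at this

theorem HasProtocol.fidelity_le [DecidableEq a₁] [DecidableEq b₁] {N M : BiMap a₁ b₁ a₂ b₂}
    {α c : ℝ} (hα : 1 < α) (hc : 0 ≤ c) (hNM : RevTestMap α c N M)
    (hM : M ∈ thetaSet a₁ b₁ a₂ b₂) {n m : ℕ} {ε : ℝ} (h : HasProtocol PPT N n m ε) :
    1 - ε ≤ (1 / m : ℝ) ^ (1 - α⁻¹) * (c ^ n) ^ α⁻¹ := by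
  obtain ⟨ω, hω, hF⟩ := h
  obtain ⟨σ, hσ, hT⟩ := hω.exists_comparison hc hNM hM
  obtain ⟨h0, h1⟩ := hσ.trace_maxEnt_le hα
  refine hF.trans (h1.trans ?_)
  refine mul_le_mul_of_nonneg_right (Real.rpow_le_rpow h0 hT.trace_maxEnt_le ?_) (by positivity)
  exact sub_nonneg.2 (inv_le_one_of_one_le₀ hα.le)

theorem isStrongConverse_of_revTestMap [DecidableEq a₁] [DecidableEq b₁]
    {N M : BiMap a₁ b₁ a₂ b₂} {α r : ℝ} (hα : 1 < α)
    (hNM : RevTestMap α (2 ^ ((α - 1) * r)) N M) (hM : M ∈ thetaSet a₁ b₁ a₂ b₂) :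
    IsStrongConverse PPT N r := by
  intro ε _ hε δ hδ
  have hα0 : 0 < α := by linarith
  have hk : 0 < (1 - α⁻¹) * δ := mul_pos (sub_pos.2 (inv_lt_one_of_one_lt₀ hα)) hδ
  have hev : ∀ᶠ n : ℕ in Filter.atTop, - Real.logb 2 (1 - ε) < n * ((1 - α⁻¹) * δ) :=
    (tendsto_natCast_atTop_atTop.atTop_mul_const hk).eventually_gt_atTop _
  filter_upwards [hev] with n hn m hm hprot
  have h := hprot.fidelity_le hα (by positivity) hNM hM
  -- Since `logb 2 0 = 0`, the rate condition need not exclude `m = 0`; there the fidelity bound is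
  -- `0`, below `1 - ε`.
  rcases Nat.eq_zero_or_pos m with rfl | hm0
  · rw [Nat.cast_zero, div_zero, Real.zero_rpow (sub_pos.2 (inv_lt_one_of_one_lt₀ hα)).ne',
      zero_mul] at h
    linarith
  have hm1 : (0 : ℝ) < m := by exact_mod_cast hm0
  have hl := Real.logb_le_logb_of_le one_lt_two (by linarith) h
  rw [Real.logb_mul (by positivity) (by positivity), Real.logb_rpow_eq_mul_logb_of_pos (by positivity),
    Real.logb_rpow_eq_mul_logb_of_pos (by positivity), Real.logb_pow,
    Real.logb_rpow (by norm_num) (by norm_num), one_div, Real.logb_inv] at hl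
  have h1 : (1 - α⁻¹) * (n * (r + δ)) ≤ (1 - α⁻¹) * Real.logb 2 m :=
    mul_le_mul_of_nonneg_left hm (sub_pos.2 (inv_lt_one_of_one_lt₀ hα)).le
  have h2 : α⁻¹ * (n * ((α - 1) * r)) = (1 - α⁻¹) * (n * r) := by
    field_simp
  nlinarith

theorem strongConverseCapacity_PPT_le [DecidableEq a₁] [DecidableEq b₁] [DecidableEq a₂]
    [DecidableEq b₂] [Nonempty a₁] [Nonempty b₁] {N : BiMap a₁ b₁ a₂ b₂} (hN : IsChannel N) {α : ℝ}
    (hα : 1 < α) : strongConverseCapacity PPT N ≤ geomThetaInfo α N := by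
  refine le_iInf₂ fun M hM => ?_
  -- Every real `r` above the divergence is a strong converse rate; an infinite divergence leaves
  -- nothing to check.
  refine EReal.le_of_forall_lt_iff_le.1 fun r hr => ?_
  exact iInf₂_le r (isStrongConverse_of_revTestMap hα
    (RevTestMap.of_geomChannelDiv_le hN.1 hM.1 hα hr.le) hM)

theorem capacity_le_strongConverseCapacity (O : OpClass) (N : BiMap a₁ b₁ a₂ b₂) :
    capacity O N ≤ strongConverseCapacity O N := by
  refine iSup₂_le fun r hr => le_iInf₂ fun s hs => EReal.coe_le_coe_iff.2 ?_
  by_contra! hlt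
  -- With `δ = (r - s) / 2` both definitions speak of the midpoint rate `r - δ = s + δ`.
  obtain ⟨n, ⟨m, hm, hp⟩, hn⟩ := ((hr (1 / 2) (by norm_num) ((r - s) / 2) (by linarith)).and
    (hs (1 / 2) (by norm_num) (by norm_num) ((r - s) / 2) (by linarith))).exists
  refine hn m (le_trans (le_of_eq ?_) hm) hp
  ring

end StrongConverse

/-! ### LOCC channels are PPT -/

section LOCCSubPPT

open Matrix

variable {a b c d : Type}

theorem IsCP.comp {L : OpMap b c} {E : OpMap a b} (hL : IsCP L) (hE : IsCP E) : IsCP (L ∘ₗ E) :=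
  fun k X hX => hL k _ (hE k X hX)

theorem IsCP.sum {κ : Type} (s : Finset κ) {E : κ → OpMap a b} (hE : ∀ k, IsCP (E k)) :
    IsCP (∑ k ∈ s, E k) := by
  intro n X hX
  have : idTensor (Fin n) (∑ k ∈ s, E k) X = ∑ k ∈ s, idTensor (Fin n) (E k) X := by
    ext p q
    simp [idTensor, Matrix.sum_apply]
  rw [this]
  exact posSemidef_sum _ fun k _ => hE k n X hX

theorem isCP_id : IsCP (LinearMap.id : OpMap a a) := fun _ _ hX => hX

theorem IsCP.tensorId {E : OpMap a c} (hE : IsCP E) (b : Type) [Fintype b] :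
    IsCP (tensorId E b) := fun k _ hX =>
  (hE.idTensor_posSemidef (r := Fin k × b)
    (hX.submatrix fun p : (Fin k × b) × a => (p.1.1, (p.2, p.1.2)))).submatrix
      fun p : Fin k × (c × b) => ((p.1, p.2.2), p.2.1)

theorem IsCP.idTensor {E : OpMap b c} (hE : IsCP E) (a : Type) [Fintype a] :
    IsCP (idTensor a E) := fun k _ hX =>
  (hE.idTensor_posSemidef (r := Fin k × a)
    (hX.submatrix fun p : (Fin k × a) × b => (p.1.1, (p.1.2, p.2)))).submatrix
      fun p : Fin k × (a × c) => ((p.1, p.2.1), p.2.2)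

/-- The conjugate of a map by transposition. -/
def transposeConj (E : OpMap a b) : OpMap a b where
  toFun X := (E Xᵀ)ᵀ
  map_add' X Y := by simp
  map_smul' c X := by simp

theorem IsCP.transposeConj {E : OpMap a b} (hE : IsCP E) : IsCP (transposeConj E) :=
  fun k _ hX => (hE k _ hX.transpose).transpose

theorem transposeBob_tensorId (E : OpMap a c) (X : Matrix (a × b) (a × b) ℂ) :
    BidirectionalCapacity.tensorId E b (transposeBob a b X) =
      transposeBob c b (BidirectionalCapacity.tensorId E b X) := rfl

theorem transposeBob_idTensor (E : OpMap b c) (X : Matrix (a × b) (a × b) ℂ) :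
    BidirectionalCapacity.idTensor a E (transposeBob a b X) =
      transposeBob a c (BidirectionalCapacity.idTensor a (BidirectionalCapacity.transposeConj E) X) :=
  rfl

theorem trace_tensorId [Fintype a] [Fintype b] [Fintype c] (E : OpMap a c)
    (X : Matrix (a × b) (a × b) ℂ) : (BidirectionalCapacity.tensorId E b X).trace =
      ∑ s, (E (X.submatrix (fun i => (i, s)) (fun j => (j, s)))).trace := by
  simp only [trace, diag_apply, BidirectionalCapacity.tensorId, LinearMap.coe_mk, AddHom.coe_mk,
    of_apply, Fintype.sum_prod_type]
  exact Finset.sum_comm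

/-- Alice's maps commute with `T_B`. Bob's map `E` passes through it as `X ↦ (E Xᵀ)ᵀ`, which is
again completely positive, so the PPT property propagates round by round. -/
theorem IsLOCC.isPPT {a' b' : Type} [Fintype a'] [Fintype b'] {a b : Type} [Fintype a] [Fintype b]
    {P : BiMap a b a' b'} (h : IsLOCC a' b' a b P) : PPT P := by
  induction h with
  | done =>
    refine ⟨⟨isCP_id, fun X => ?_⟩, isCP_id⟩
    congr!
  | alice a b c E L cp tp rest ih =>
    refine ⟨⟨IsCP.sum _ fun k => (ih k).1.1.comp ((cp k).tensorId b), fun X => ?_⟩, ?_⟩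
    · simp only [LinearMap.sum_apply, LinearMap.comp_apply, trace_sum, (ih _).1.2, trace_tensorId]
      rw [Finset.sum_comm]
      simp only [tp]
      simp only [trace, diag_apply, submatrix_apply, Fintype.sum_prod_type]
      exact Finset.sum_comm
    · have : transposeBob a' b' ∘ₗ (∑ k, L k ∘ₗ BidirectionalCapacity.tensorId (E k) b) ∘ₗ
          transposeBob a b = ∑ k, (transposeBob a' b' ∘ₗ L k ∘ₗ transposeBob (c k) b) ∘ₗ
            BidirectionalCapacity.tensorId (E k) b := by
        ext1 X
        simp only [LinearMap.comp_apply, LinearMap.sum_apply, map_sum, transposeBob_tensorId]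
      rw [this]
      exact IsCP.sum _ fun k => (ih k).2.comp ((cp k).tensorId b)
  | bob a b c E L cp tp rest ih =>
    refine ⟨⟨IsCP.sum _ fun k => (ih k).1.1.comp ((cp k).idTensor a), fun X => ?_⟩, ?_⟩
    · simp only [LinearMap.sum_apply, LinearMap.comp_apply, trace_sum, (ih _).1.2, trace_idTensor]
      rw [tp, trace_sum]
      simp [trace, Fintype.sum_prod_type]
    · have : transposeBob a' b' ∘ₗ (∑ k, L k ∘ₗ BidirectionalCapacity.idTensor a (E k)) ∘ₗ
          transposeBob a b = ∑ k, (transposeBob a' b' ∘ₗ L k ∘ₗ transposeBob a (c k)) ∘ₗ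
            BidirectionalCapacity.idTensor a (BidirectionalCapacity.transposeConj (E k)) := by
        ext1 X
        simp only [LinearMap.comp_apply, LinearMap.sum_apply, map_sum, transposeBob_idTensor]
      rw [this]
      exact IsCP.sum _ fun k => (ih k).2.comp ((cp k).transposeConj.idTensor a)

variable {a₁ b₁ a₂ b₂ : Type} [Fintype a₁] [Fintype b₁] [Fintype a₂] [Fintype b₂]

theorem Prepares.ppt_of_locc {N : BiMap a₁ b₁ a₂ b₂} {n : ℕ} {a b : Type} [Fintype a] [Fintype b]
    {ω : Matrix (a × b) (a × b) ℂ} (h : Prepares LOCC N n a b ω) : Prepares PPT N n a b ω := by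
  induction h with
  | start a b P hP => exact .start a b P hP.isPPT
  | use n x y a b ρ _ P hP ih => exact .use n x y a b ρ ih P hP.isPPT

theorem strongConverseCapacity_LOCC_le_PPT (N : BiMap a₁ b₁ a₂ b₂) :
    strongConverseCapacity LOCC N ≤ strongConverseCapacity PPT N := by
  refine le_iInf₂ fun r hr => iInf₂_le r fun ε hε hε1 δ hδ => ?_
  filter_upwards [hr ε hε hε1 δ hδ] with n hn m hm ⟨ω, hω, hF⟩
  exact hn m hm ⟨ω, hω.ppt_of_locc, hF⟩

end LOCCSubPPT

/-! ### The comparison with the max-Rains information -/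

section MaxRains

open Matrix

theorem opNorm_smul_one_sub_posSemidef {a : Type} [Fintype a] [DecidableEq a] {X : Matrix a a ℂ}
    (hX : X.IsHermitian) : (opNorm X • (1 : Matrix a a ℂ) - X).PosSemidef := by
  open scoped MatrixOrder Matrix.Norms.L2Operator in
  have h := IsSelfAdjoint.le_algebraMap_norm_self (a := X) hX.isSelfAdjoint
  rw [Matrix.le_iff, Algebra.algebraMap_eq_smul_one] at h
  exact h

theorem suppLE_of_le {a : Type} [Fintype a] {ρ σ : Matrix a a ℂ} (hρ : ρ.PosSemidef) {y : ℝ}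
    (h : (y • σ - ρ).PosSemidef) : SuppLE ρ σ := by
  intro v hv
  have hv : σ *ᵥ v = 0 := hv
  have h1 := h.dotProduct_mulVec_nonneg v
  rw [sub_mulVec, smul_mulVec, hv, smul_zero, zero_sub, dotProduct_neg, Left.nonneg_neg_iff] at h1
  exact (hρ.dotProduct_mulVec_zero_iff v).1 (le_antisymm h1 (hρ.dotProduct_mulVec_nonneg v))

/-- In the common decomposition all weights satisfy `l ≤ y`, so `l ^ α ≤ y ^ (α - 1) * l`, and the
weights `l` sum to `tr ρ = 1`. -/
theorem geomDiv_le_logb {a : Type} [Fintype a] [DecidableEq a] {ρ σ : Matrix a a ℂ}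
    (hρ : ρ.PosSemidef) (hσ : σ.PosSemidef) (hρ1 : ρ.trace = 1) {α y : ℝ} (hα : 1 < α)
    (hy : 1 ≤ y) (h : (y • σ - ρ).PosSemidef) : geomDiv α ρ σ ≤ (Real.logb 2 y : EReal) := by
  have hy0 : 0 < y := by linarith
  have hs := suppLE_of_le hρ h
  rw [geomDiv, if_pos hs, EReal.coe_le_coe_iff, inv_mul_le_iff₀ (by linarith)]
  obtain ⟨L, l, hl, -, hρL, hG, hly⟩ := exists_geomMean_decomposition hρ hσ hs α
  have htr : ∀ w : a → ℝ, (L * diagonal (fun i => (w i : ℂ)) * Lᴴ).trace =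
      ((∑ k, w k * ∑ i, ‖L.col k i‖ ^ 2 : ℝ) : ℂ) := by
    intro w
    rw [mul_diagonal_mul_conjTranspose, trace_sum]
    simp only [trace_smul, trace_vecMulVec_star, smul_eq_mul]
    push_cast
    rfl
  have h1 : ∑ k, l k * ∑ i, ‖L.col k i‖ ^ 2 = 1 := by
    rw [hρL, htr] at hρ1
    exact_mod_cast hρ1
  have hQ : (geomMean α σ ρ).trace.re ≤ y ^ (α - 1) := by
    rw [hG, htr, Complex.ofReal_re]
    calc _ ≤ ∑ k, y ^ (α - 1) * (l k * ∑ i, ‖L.col k i‖ ^ 2) := by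
          refine Finset.sum_le_sum fun k _ => ?_
          rw [← mul_assoc]
          refine mul_le_mul_of_nonneg_right ?_ (by positivity)
          rcases (hl k).eq_or_lt with h0 | h0
          · rw [← h0, Real.zero_rpow (by linarith), mul_zero]
          · rw [← div_le_iff₀ h0, ← Real.rpow_sub_one h0.ne']
            exact Real.rpow_le_rpow h0.le (hly y hy0.le h k) (by linarith)
      _ = y ^ (α - 1) := by rw [← Finset.mul_sum, h1, mul_one]
  have hlog : 0 ≤ (α - 1) * Real.logb 2 y :=
    mul_nonneg (by linarith) (Real.logb_nonneg one_lt_two hy)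
  -- A zero trace would give `logb 2 0 = 0`, which `1 ≤ y` absorbs.
  rcases le_or_gt (geomMean α σ ρ).trace.re 0 with h0 | h0
  · have hQ0 : 0 ≤ (geomMean α σ ρ).trace.re := by
      rw [hG, htr, Complex.ofReal_re]
      exact Finset.sum_nonneg fun k _ => mul_nonneg (Real.rpow_nonneg (hl k) _) (by positivity)
    rw [le_antisymm h0 hQ0, Real.logb_zero]
    exact hlog
  · rw [← Real.logb_rpow_eq_mul_logb_of_pos hy0]
    exact Real.logb_le_logb_of_le one_lt_two h0 hQ

theorem IsCP.smul {a b : Type} {N : OpMap a b} (hN : IsCP N) {y : ℝ} (hy : 0 ≤ y) :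
    IsCP ((y : ℂ) • N) := by
  intro k X hX
  have : BidirectionalCapacity.idTensor (Fin k) ((y : ℂ) • N) X =
      y • BidirectionalCapacity.idTensor (Fin k) N X := by
    ext p q
    simp [BidirectionalCapacity.idTensor]
  rw [this]
  exact (hN k X hX).smul hy

theorem geomChannelDiv_le_logb {a b : Type} [Fintype a] [Fintype b] [DecidableEq b]
    {N M : OpMap a b} (hN : IsChannel N) (hM : IsCP M) {α y : ℝ} (hα : 1 < α) (hy : 1 ≤ y)
    (h : IsCP ((y : ℂ) • M - N)) : geomChannelDiv α N M ≤ (Real.logb 2 y : EReal) := by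
  refine iSup_le fun k => iSup_le fun ψ => iSup_le fun hψ => ?_
  have hφ := posSemidef_vecMulVec_self_star ψ
  refine geomDiv_le_logb (hN.1 k _ hφ) (hM k _ hφ) ?_ hα hy ?_
  · rw [trace_idTensor, hN.2, trace_sum]
    have h1 := trace_vecMulVec_star ψ
    rw [hψ] at h1
    simpa [trace, Fintype.sum_prod_type] using h1
  · convert h k _ hφ using 1
    ext p q
    simp [idTensor]

variable {a₁ b₁ a₂ b₂ : Type} [Fintype a₁] [Fintype b₁] [Fintype a₂] [Fintype b₂]
  [DecidableEq a₁] [DecidableEq b₁] [DecidableEq a₂] [DecidableEq b₂] [Nonempty a₁] [Nonempty b₁]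

omit [DecidableEq a₂] [DecidableEq b₂] [Nonempty a₁] [Nonempty b₁] in
theorem trace_choi {N : BiMap a₁ b₁ a₂ b₂} (hN : IsChannel N) :
    (choi N).trace = Fintype.card (a₁ × b₁) := by
  have : (choi N).trace = ∑ i, (N (single i i 1)).trace := by
    simp only [trace, diag_apply, choi, of_apply]
    exact Fintype.sum_prod_type _
  simp [this, hN.2]

omit [DecidableEq a₂] [DecidableEq b₂] in
-- Taking traces with `d` the input dimension: `d = tr J_N ≤ tr (V - Y) ≤ tr (V + Y) ≤ d ‖tr_{A₂B₂}
-- (V + Y)‖`.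
theorem one_le_of_maxRains_feasible {N : BiMap a₁ b₁ a₂ b₂} (hN : IsChannel N)
    {V Y : Matrix ((a₁ × b₁) × (a₂ × b₂)) ((a₁ × b₁) × (a₂ × b₂)) ℂ}
    (hV : V.PosSemidef) (hY : Y.PosSemidef)
    (h : (choiTransposeBob (V - Y) - choi N).PosSemidef) : 1 ≤ opNorm (traceRight (V + Y)) := by
  have h1 := (Complex.nonneg_iff.1 (opNorm_smul_one_sub_posSemidef
    (traceRight_posSemidef (hV.add hY)).1).trace_nonneg).1
  have h2 := (Complex.nonneg_iff.1 h.trace_nonneg).1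
  have h3 := (Complex.nonneg_iff.1 hY.trace_nonneg).1
  have h4 : (choiTransposeBob (V - Y)).trace = (V - Y).trace := rfl
  rw [trace_sub, trace_choi hN, h4, trace_sub] at h2
  rw [trace_sub, trace_traceRight, trace_add, trace_smul, trace_one, Complex.real_smul] at h1
  simp only [Complex.sub_re, Complex.add_re, Complex.re_ofReal_mul, Complex.natCast_re] at h1 h2
  have hd : (0 : ℝ) < Fintype.card (a₁ × b₁) := by exact_mod_cast Fintype.card_pos
  have : 1 * (Fintype.card (a₁ × b₁) : ℝ) ≤
      opNorm (traceRight (V + Y)) * Fintype.card (a₁ × b₁) := by linarith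
  exact le_of_mul_le_mul_right this hd

theorem geomThetaInfo_le_logb_of_feasible {N : BiMap a₁ b₁ a₂ b₂} (hN : IsChannel N) {α : ℝ}
    (hα : 1 < α) {V Y : Matrix ((a₁ × b₁) × (a₂ × b₂)) ((a₁ × b₁) × (a₂ × b₂)) ℂ}
    (hV : V.PosSemidef) (hY : Y.PosSemidef)
    (h : (choiTransposeBob (V - Y) - choi N).PosSemidef) :
    geomThetaInfo α N ≤ (Real.logb 2 (opNorm (traceRight (V + Y))) : EReal) := by
  have hy := one_le_of_maxRains_feasible hN hV hY h
  have hT := opNorm_smul_one_sub_posSemidef (traceRight_posSemidef (hV.add hY)).1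
  set y := opNorm (traceRight (V + Y)) with hydef
  have hy0 : 0 < y := by linarith
  set K := choiTransposeBob (V - Y) with hK
  have hKpsd : K.PosSemidef := by
    have := h.add hN.1.choi_posSemidef
    rwa [sub_add_cancel] at this
  -- Dividing by `y` normalises the certificate `R = (V + Y) / y`, for which `R ± J_M^T` are `2 V /
  -- y` and `2 Y / y`; and `y M - N` has Choi matrix `K - J_N ≥ 0`.
  set M : BiMap a₁ b₁ a₂ b₂ := ((y⁻¹ : ℝ) : ℂ) • ofChoi K with hM
  have hMcp : IsCP M := (isCP_ofChoi hKpsd).smul (inv_nonneg.2 hy0.le)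
  have hchoi : choiTransposeBob (choi M) = y⁻¹ • (V - Y) := by
    have h1 : choi M = y⁻¹ • K := by
      rw [← choi_ofChoi K, hM]
      ext p q
      simp [choi]
    rw [h1, hK]
    rfl
  have hmem : M ∈ thetaSet a₁ b₁ a₂ b₂ := by
    refine ⟨hMcp, y⁻¹ • (V + Y), ?_, ?_, ?_⟩
    · rw [hchoi, ← smul_add, add_add_sub_cancel]
      exact (hV.add hV).smul (inv_nonneg.2 hy0.le)
    · rw [hchoi, ← smul_sub, add_sub_sub_cancel]
      exact (hY.add hY).smul (inv_nonneg.2 hy0.le)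
    · have h1 := hT.smul (inv_nonneg.2 hy0.le)
      convert h1 using 1
      rw [smul_sub, smul_smul, inv_mul_cancel₀ hy0.ne', one_smul]
      congr 1
      ext i j
      simp [traceRight, Finset.mul_sum, mul_add]
  refine (iInf₂_le M hmem).trans (geomChannelDiv_le_logb hN hMcp hα hy ?_)
  have h1 : (y : ℂ) • M - N = ofChoi (K - choi N) := by
    rw [ofChoi_sub, ofChoi_choi, hM, smul_smul, ← Complex.ofReal_mul, mul_inv_cancel₀ hy0.ne',
      Complex.ofReal_one, one_smul]
  rw [h1]
  exact isCP_ofChoi h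

theorem geomThetaInfo_le_maxRainsInfo {N : BiMap a₁ b₁ a₂ b₂} (hN : IsChannel N) {α : ℝ}
    (hα : 1 < α) : geomThetaInfo α N ≤ (maxRainsInfo N : EReal) := by
  rw [maxRainsInfo]
  set S := {y : ℝ | ∃ V Y : Matrix ((a₁ × b₁) × (a₂ × b₂)) ((a₁ × b₁) × (a₂ × b₂)) ℂ,
    V.PosSemidef ∧ Y.PosSemidef ∧ (choiTransposeBob (V - Y) - choi N).PosSemidef ∧
    y = opNorm (traceRight (V + Y))} with hS
  have hne : S.Nonempty := by
    -- Multiples of the identity are fixed by partial transposition and dominate `J_N` once the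
    -- factor is its norm.
    refine ⟨_, opNorm (choi N) • 1, 0, PosSemidef.one.smul (norm_nonneg _), PosSemidef.zero, ?_, rfl⟩
    have h1 : choiTransposeBob (opNorm (choi N) • (1 : Matrix ((a₁ × b₁) × (a₂ × b₂)) _ ℂ) - 0) =
        opNorm (choi N) • 1 := by
      ext ⟨⟨i, j⟩, k, l⟩ ⟨⟨i', j'⟩, k', l'⟩
      simp only [choiTransposeBob, sub_zero, of_apply, Matrix.smul_apply, one_apply, Prod.mk.injEq]
      congr 1
      exact if_congr (by tauto) rfl rfl
    rw [h1]
    exact opNorm_smul_one_sub_posSemidef hN.1.choi_posSemidef.1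
  have h1 : 1 ≤ sInf S := by
    refine le_csInf hne ?_
    rintro _ ⟨V, Y, hV, hY, h, rfl⟩
    exact one_le_of_maxRains_feasible hN hV hY h
  have h2 : ∀ y ∈ S, geomThetaInfo α N ≤ (Real.logb 2 y : EReal) := by
    rintro _ ⟨V, Y, hV, hY, h, rfl⟩
    exact geomThetaInfo_le_logb_of_feasible hN hα hV hY h
  -- No minimiser is needed: each real `t` below the Theta-information has `2 ^ t ≤ y` for all
  -- feasible `y`, hence for the infimum.
  refine EReal.ge_of_forall_gt_iff_ge.1 fun t ht => ?_
  rw [EReal.coe_le_coe_iff, Real.le_logb_iff_rpow_le one_lt_two (by linarith)]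
  refine le_csInf hne fun y hy => ?_
  have hy1 : 0 < y := by
    have := csInf_le ⟨1, ?_⟩ hy
    · linarith
    · rintro _ ⟨V, Y, hV, hY, h, rfl⟩
      exact one_le_of_maxRains_feasible hN hV hY h
  rw [← Real.le_logb_iff_rpow_le one_lt_two hy1, ← EReal.coe_le_coe_iff]
  exact ht.le.trans (h2 y hy)

end MaxRains

end BidirectionalCapacity

end

theorem mainTheorem4 {a₁ b₁ a₂ b₂ : Type} [Fintype a₁] [Fintype b₁] [Fintype a₂] [Fintype b₂]
    [DecidableEq a₁] [DecidableEq b₁] [DecidableEq a₂] [DecidableEq b₂] [Nonempty a₁] [Nonempty b₁]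
    (N : BiMap a₁ b₁ a₂ b₂) (hN : IsChannel N) (α : ℝ) (h₁ : 1 < α) (h₂ : α ≤ 2) :
    (capacity PPT N ≤ strongConverseCapacity PPT N ∧
      strongConverseCapacity PPT N ≤ geomThetaInfo α N ∧
      geomThetaInfo α N ≤ (maxRainsInfo N : EReal)) ∧
    (capacity LOCC N ≤ strongConverseCapacity LOCC N ∧
      strongConverseCapacity LOCC N ≤ geomThetaInfo α N ∧
      geomThetaInfo α N ≤ (maxRainsInfo N : EReal)) := by
  have hPPT := strongConverseCapacity_PPT_le hN h₁
  have hmax := geomThetaInfo_le_maxRainsInfo hN h₁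
  exact ⟨⟨capacity_le_strongConverseCapacity PPT N, hPPT, hmax⟩,
    ⟨capacity_le_strongConverseCapacity LOCC N,
      (strongConverseCapacity_LOCC_le_PPT N).trans hPPT, hmax⟩⟩
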